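/- **Setting.** Consider the two-stage robust program $$w^*=\min_{\mathbf x\in\mathcal X}\ \mathbf c_1\mathbf x+\max_{\mathbf u\in\mathcal U(\mathbf x)}\ \min_{\mathbf y\in\mathcal Y(\mathbf x,\mathbf u)}\mathbf c_2\mathbf y ,\qquad(\mathrm{RO})$$ where $\mathcal X=\{\mathbf x\in\mathbb R^{n_x}_+\times\mathbb Z^{m_x}_+:\mathbf A\mathbf x\ge\mathbf b\}$, $\mathcal U(\mathbf x)=\{(\mathbf u_c,\mathbf u_d)\in\mathbb R^{n_u}_+\times\mathbb U_d:\mathbf F_c(\mathbf x)\mathbf u_c+\mathbf F_d(\mathbf x)\mathbf u_d\le\mathbf h+\mathbf G\mathbf x\}$ with $\mathbb U_d\subset\mathbb Z^{m_u}_+$ finite and $\mathbf F_c,\mathbf F_d$ arbitrary matrix-valued functions of $\mathbf x$, and $\mathcal Y(\mathbf x,\mathbf u)=\{\mathbf y\ge\mathbf 0:\mathbf B_2\mathbf y\ge\mathbf r(\mathbf x,\mathbf u)\}$ with $\mathbf r(\mathbf x,\mathbf u)=\mathbf d-\mathbf B_1\mathbf x-\mathbf E_c\mathbf u_c-\mathbf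 E_d\mathbf u_d$. Assume that for every $\mathbf x\in\mathcal X$ the set $\mathcal U(\mathbf x)$ is non-empty and bounded, and that $\mathbf c_1\mathbf x+\mathbf c_2\mathbf y$ is bounded below over $\mathbf x\in\mathcal X,\ \mathbf u\in\mathcal U(\mathbf x),\ \mathbf y\in\mathcal Y(\mathbf x,\mathbf u)$. Call $\mathbf x\in\mathcal X$ feasible if $\mathcal Y(\mathbf x,\mathbf u)\ne\emptyset$ for all $\mathbf u\in\mathcal U(\mathbf x)$; $(\mathrm{RO})$ is infeasible if no $\mathbf x$ is feasible. Let $\eta_o(\mathbf x)=\max_{\mathbf u\in\mathcal U(\mathbf x)}\min_{\mathbf y\in\mathcal Y(\mathbf x,\mathbf u)}\mathbf c_2\mathbf y$ and $\eta_f(\mathbf x)=\max_{\mathbf u\in\mathcal U(\mathbf x)}\min\{\mathbf 1^\intercal\tilde{\mathbf y}:\mathbf B_2\mathbf y+\tilde{\mathbf y}\ge\mathbf r(\mathbf x,\mathbf u),\ \mathbf y,\tilde{\mathbf y}\ge\mathbf 0\}$. Let $\mathcal P_\Pi$ be the set of extreme points of $\Pi=\{\pi\ge\mathbf 0:\mathbf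 B_2^\intercal\pi\le\mathbf c_2^\intercal\}$, and $\mathcal R_\Pi$ its set of extreme rays, i.e. the extreme rays of $\{\gamma\ge\mathbf 0:\mathbf B_2^\intercal\gamma\le\mathbf 0\}$, normalized by $\mathbf 1^\intercal\gamma=1$. **Optimal-solution sets.** For a penalty coefficient $M(\mathbf x)$ (a constant $M$ being a special case), $\mathbf u_d\in\mathbb U_d$ and $\beta\in\mathcal P_\Pi\cup\mathcal R_\Pi$, let $\mathcal K(\mathbf x,\mathbf u_d,\beta)$ be the set of $(\mathbf u_c,\tilde{\mathbf u},\lambda)$ satisfying the KKT conditions of $$\max\{(-\mathbf E_c\mathbf u_c)^\intercal\beta-M(\mathbf x)\mathbf 1^\intercal\tilde{\mathbf u}:\ \mathbf F_c(\mathbf x)\mathbf u_c-\tilde{\mathbf u}\le\mathbf h+\mathbf G\mathbf x-\mathbf F_d(\mathbf x)\mathbf u_d,\ \mathbf u_c,\tilde{\mathbf u}\ge\mathbf 0\};$$ it is written $\mathcal{OU}$ if $\beta\in\mathcal P_\Pi$ and $\mathcal{OV}$ if $\beta\in\mathcal R_\Pi$. Put $\dot u(\mathbf 0)=0$ and $\dot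 u(\tilde{\mathbf u})=+\infty$ for $\tilde{\mathbf u}\ne\mathbf 0$. **Algorithm (parametric C&CG-MIU, tolerance $0$, no initial pairs).** Start with $LB=-\infty$, $UB=+\infty$ and empty sets $O$ of pairs $(\mathbf u_d,\pi)$ and $F$ of pairs $(\mathbf u_d,\gamma)$. In each iteration: 1. Consider the master problem: minimize $\mathbf c_1\mathbf x+\eta$ over $\mathbf x\in\mathcal X$, $\eta\in\mathbb R\cup\{-\infty\}$, subject to the existence, for each $(\mathbf u_d,\pi)\in O$, of $(\mathbf u_c,\tilde{\mathbf u},\cdot)\in\mathcal{OU}(\mathbf x,\mathbf u_d,\pi)$ and $\mathbf y\ge\mathbf 0$ with $\eta\ge\mathbf c_2\mathbf y-\dot u(\tilde{\mathbf u})$ and $\mathbf B_2\mathbf y+\mathbf E_c\mathbf u_c+\dot u(\tilde{\mathbf u})\ge\mathbf d-\mathbf B_1\mathbf x-\mathbf E_d\mathbf u_d$, and, for each $(\mathbf u_d,\gamma)\in F$, of $(\mathbf v_c,\tilde{\mathbf v},\cdot)\in\mathcal{OV}(\mathbf x,\mathbf u_d,\gamma)$ and $\mathbf y\ge\mathbf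 0$ with $\mathbf B_2\mathbf y+\mathbf E_c\mathbf v_c+\dot u(\tilde{\mathbf v})\ge\mathbf d-\mathbf B_1\mathbf x-\mathbf E_d\mathbf u_d$. If it is infeasible, report that $(\mathrm{RO})$ is infeasible and terminate. Otherwise take an optimal solution $(\mathbf x^*,\eta^*)$ and let $LB$ be the optimal value. 2. If $\eta_f(\mathbf x^*)=0$, take a maximizer $\mathbf u^*_o=(\mathbf u^*_{oc},\mathbf u^*_{od})$ in $\eta_o(\mathbf x^*)$ and $\pi^*\in\mathcal P_\Pi$ maximizing $\mathbf r(\mathbf x^*,\mathbf u^*_o)^\intercal\pi$ over $\Pi$, and add $(\mathbf u^*_{od},\pi^*)$ to $O$. If $\eta_f(\mathbf x^*)>0$, take a maximizer $\mathbf u^*_f=(\mathbf u^*_{fc},\mathbf u^*_{fd})$ in $\eta_f(\mathbf x^*)$ and $\gamma^*\in\mathcal R_\Pi$ with $\mathbf r(\mathbf x^*,\mathbf u^*_f)^\intercal\gamma^*>0$, add $(\mathbf u^*_{fd},\gamma^*)$ to $F$, and use the value $\eta_o(\mathbf x^*)=+\infty$. 3. Replace $UB$ by $\min\{UB,\mathbf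 c_1\mathbf x^*+\eta_o(\mathbf x^*)\}$, and record $\mathbf x^*$ as incumbent if $\mathbf c_1\mathbf x^*+\eta_o(\mathbf x^*)$ does not exceed the previous $UB$. If $UB-LB\le0$, return the incumbent and terminate. **Theorem.** There are an integer $N$ and a function $M_0$ of the matrix $\mathbf F_c(\mathbf x)$, depending only on the data of $(\mathrm{RO})$, such that for every $M$ with $M(\mathbf x)\ge M_0(\mathbf F_c(\mathbf x))$ for all $\mathbf x\in\mathcal X$, and for all choices of optimal solutions, points and rays in the course of the algorithm: - (a) if an iteration generates a pair $(\mathbf u^*_{fd},\gamma^*)$ or $(\mathbf u^*_{od},\pi^*)$ that was already generated in an earlier iteration, then the algorithm terminates in that iteration; - (b) if the algorithm reports infeasibility, then $(\mathrm{RO})$ is infeasible; - (c) if it terminates by $UB-LB\le 0$, then the returned $\mathbf x$ is an exact optimal solution: it is feasible and $\mathbf c_1\mathbf x+\eta_o(\mathbf x)=w^*$; moreover $LB=UB=w^*$; - (d) the algorithm performs at most $N$ iterations; - (e) whenever the master problem has an optimal solution $(\mathbf x^*,\eta^*)$, the rest of the iteration can be carried out, i.e. the required maximizers, extreme point or extreme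 ray exist. In particular, if every feasible master problem attains its minimum, the algorithm terminates after finitely many iterations, either by a correct report of infeasibility or with an exact optimal solution. -/

import Mathlib

open scoped Matrix

noncomputable section

namespace TwoStageRO

/-- Data of a two-stage robust program with a mixed-integer decision-dependent uncertainty set and
a linear recourse problem.  There are `nx` continuous and `mx` integer first-stage variables,
`nu` continuous and `mu` integer uncertain parameters, and `ny` (continuous) recourse variables;
`kx`, `ku`, `ky` are the numbers of constraints of the first stage, of the uncertainty set and of
the recourse problem.  `Fc` and `Fd` are arbitrary functions of the first-stage decision. -/
structure Data (nx mx nu mu ny kx ku ky : ℕ) where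
  c₁ : Fin nx ⊕ Fin mx → ℝ
  c₂ : Fin ny → ℝ
  A : Matrix (Fin kx) (Fin nx ⊕ Fin mx) ℝ
  b : Fin kx → ℝ
  /-- The bounded (that is, finite) set of admissible discrete scenarios. -/
  Ud : Finset (Fin mu → ℕ)
  Fc : (Fin nx ⊕ Fin mx → ℝ) → Matrix (Fin ku) (Fin nu) ℝ
  Fd : (Fin nx ⊕ Fin mx → ℝ) → Matrix (Fin ku) (Fin mu) ℝ
  h : Fin ku → ℝ
  G : Matrix (Fin ku) (Fin nx ⊕ Fin mx) ℝ
  B₁ : Matrix (Fin ky) (Fin nx ⊕ Fin mx) ℝ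
  B₂ : Matrix (Fin ky) (Fin ny) ℝ
  Ec : Matrix (Fin ky) (Fin nu) ℝ
  Ed : Matrix (Fin ky) (Fin mu) ℝ
  d : Fin ky → ℝ

variable {nx mx nu mu ny kx ku ky : ℕ}

namespace Data

variable (P : Data nx mx nu mu ny kx ku ky)

/-! ### The two-stage robust program -/

/-- The first-stage feasible set `𝒳 = {x ∈ ℝ₊^nx × ℤ₊^mx : A x ≥ b}`. -/
def X : Set (Fin nx ⊕ Fin mx → ℝ) :=
  {x | 0 ≤ x ∧ (∀ j : Fin mx, ∃ k : ℕ, x (Sum.inr j) = k) ∧ P.b ≤ P.A *ᵥ x}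

/-- Right-hand side of the constraints on `u_c` once `x` and `u_d` are fixed:
`h + G x - F_d(x) u_d`. -/
def uRhs (x : Fin nx ⊕ Fin mx → ℝ) (ud : Fin mu → ℕ) : Fin ku → ℝ :=
  P.h + P.G *ᵥ x - P.Fd x *ᵥ (fun j => (ud j : ℝ))

/-- The mixed-integer decision-dependent uncertainty set `𝒰(x)`. -/
def U (x : Fin nx ⊕ Fin mx → ℝ) : Set ((Fin nu → ℝ) × (Fin mu → ℕ)) :=
  {u | 0 ≤ u.1 ∧ u.2 ∈ P.Ud ∧ P.Fc x *ᵥ u.1 ≤ P.uRhs x u.2}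

/-- Right-hand side of the recourse problem: `d - B₁ x - E_c u_c - E_d u_d`. -/
def yRhs (x : Fin nx ⊕ Fin mx → ℝ) (u : (Fin nu → ℝ) × (Fin mu → ℕ)) : Fin ky → ℝ :=
  P.d - P.B₁ *ᵥ x - P.Ec *ᵥ u.1 - P.Ed *ᵥ (fun j => (u.2 j : ℝ))

/-- The feasible set `𝒴(x, u)` of the recourse problem. -/
def Y (x : Fin nx ⊕ Fin mx → ℝ) (u : (Fin nu → ℝ) × (Fin mu → ℕ)) : Set (Fin ny → ℝ) :=
  {y | 0 ≤ y ∧ P.yRhs x u ≤ P.B₂ *ᵥ y}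

/-- Optimal value of the recourse problem (`⊤` if it is infeasible). -/
def recourseValue (x : Fin nx ⊕ Fin mx → ℝ) (u : (Fin nu → ℝ) × (Fin mu → ℕ)) : EReal :=
  ⨅ y ∈ P.Y x u, ((P.c₂ ⬝ᵥ y : ℝ) : EReal)

/-- The worst-case recourse cost `η_o(x)`, optimal value of `SP2`. -/
def etaO (x : Fin nx ⊕ Fin mx → ℝ) : EReal :=
  ⨆ u ∈ P.U x, P.recourseValue x u

/-- The optimal value `w*` of the two-stage robust program. -/
def optValue : EReal :=
  ⨅ x ∈ P.X, ((P.c₁ ⬝ᵥ x : ℝ) : EReal) + P.etaO x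

/-- A first-stage decision is feasible if the recourse problem is feasible in every scenario. -/
def FirstStageFeasible (x : Fin nx ⊕ Fin mx → ℝ) : Prop :=
  x ∈ P.X ∧ ∀ u ∈ P.U x, (P.Y x u).Nonempty

/-- The two-stage robust program is infeasible. -/
def Infeasible : Prop := ∀ x, ¬ P.FirstStageFeasible x

/-- `x` is an (exact) optimal first-stage solution of the two-stage robust program. -/
def IsOptimalSolution (x : Fin nx ⊕ Fin mx → ℝ) : Prop :=
  P.FirstStageFeasible x ∧ ((P.c₁ ⬝ᵥ x : ℝ) : EReal) + P.etaO x = P.optValue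

/-! ### Standing assumptions -/

/-- (A1) The uncertainty set is never empty. -/
def A1 : Prop := ∀ x ∈ P.X, (P.U x).Nonempty

/-- (A2) The uncertainty set is always bounded. -/
def A2 : Prop := ∀ x ∈ P.X, Bornology.IsBounded (P.U x)

/-- (A3) The monolithic relaxation
`min {c₁ x + c₂ y : x ∈ 𝒳, u ∈ 𝒰(x), y ∈ 𝒴(x, u)}` has an optimal value `> -∞`. -/
def A3 : Prop :=
  BddBelow {w : ℝ | ∃ x ∈ P.X, ∃ u ∈ P.U x, ∃ y ∈ P.Y x u, w = P.c₁ ⬝ᵥ x + P.c₂ ⬝ᵥ y}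

/-! ### The dual of the recourse problem -/

/-- The dual feasible set `Π = {π ≥ 0 : B₂ᵀ π ≤ c₂}`. -/
def dualSet : Set (Fin ky → ℝ) := {π | 0 ≤ π ∧ P.B₂ᵀ *ᵥ π ≤ P.c₂}

/-- The extreme points `𝒫_Π` of `Π`. -/
def dualPoints : Set (Fin ky → ℝ) := Set.extremePoints ℝ P.dualSet

/-- The recession cone `{γ ≥ 0 : B₂ᵀ γ ≤ 0}` of `Π`. -/
def dualCone : Set (Fin ky → ℝ) := {γ | 0 ≤ γ ∧ P.B₂ᵀ *ᵥ γ ≤ 0}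

/-- The extreme rays `ℛ_Π` of `Π`, each represented by its direction vector with entries summing
to one: `γ` is a direction that splits within the recession cone only into multiples of itself. -/
def dualRays : Set (Fin ky → ℝ) :=
  {γ | γ ∈ P.dualCone ∧ ∑ i, γ i = 1 ∧
    ∀ a ∈ P.dualCone, ∀ b ∈ P.dualCone, a + b = γ → ∃ t : ℝ, a = t • γ}

/-! ### The parametric sets of optimal solutions and the master problem -/

/-- The KKT system of the penalized linear program
`max {(-E_c u_c)ᵀ β - M 1ᵀ ũ : F_c(x) u_c - ũ ≤ h + G x - F_d(x) u_d, u_c ≥ 0, ũ ≥ 0}`, in the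
variables `(u_c, ũ, λ)`.  It is the set `𝒪𝒰(x, u_d, β)` when `β` is an extreme point of `Π` and
the set `𝒪𝒱(x, u_d, β)` when `β` is an extreme ray of `Π`. -/
def KKT (M : ℝ) (x : Fin nx ⊕ Fin mx → ℝ) (ud : Fin mu → ℕ) (β : Fin ky → ℝ) :
    Set ((Fin nu → ℝ) × (Fin ku → ℝ) × (Fin ku → ℝ)) :=
  {z | P.Fc x *ᵥ z.1 - z.2.1 ≤ P.uRhs x ud ∧
    -(P.Ecᵀ *ᵥ β) ≤ (P.Fc x)ᵀ *ᵥ z.2.2 ∧ (∀ i, z.2.2 i ≤ M) ∧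
    (∀ i, z.2.2 i * (P.uRhs x ud - P.Fc x *ᵥ z.1 + z.2.1) i = 0) ∧
    (∀ j, z.1 j * ((P.Fc x)ᵀ *ᵥ z.2.2 + P.Ecᵀ *ᵥ β) j = 0) ∧
    (∀ i, z.2.1 i * (M - z.2.2 i) = 0) ∧
    0 ≤ z.1 ∧ 0 ≤ z.2.1 ∧ 0 ≤ z.2.2}

open Classical in
/-- The indicator `u̇(ũ)`: `0` if `ũ = 0`, and `+∞` otherwise. -/
def uDot (ut : Fin ku → ℝ) : EReal := if ut = 0 then 0 else ⊤

/-- The constraints `B₂ y + E_c u_c + u̇(ũ) ≥ d - B₁ x - E_d u_d`, `y ≥ 0` shared by both kinds of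
cutting sets. -/
def RecourseRows (x : Fin nx ⊕ Fin mx → ℝ) (ud : Fin mu → ℕ) (uc : Fin nu → ℝ)
    (ut : Fin ku → ℝ) (y : Fin ny → ℝ) : Prop :=
  0 ≤ y ∧ ∀ i, (((P.d - P.B₁ *ᵥ x - P.Ed *ᵥ (fun j => (ud j : ℝ))) i : ℝ) : EReal) ≤
    (((P.B₂ *ᵥ y + P.Ec *ᵥ uc) i : ℝ) : EReal) + uDot ut

/-- The optimality cutting set of the pair `(u_d, π)` is satisfied by `(x, η)` for suitable values
of its auxiliary variables. -/
def OptimalityCut (M : ℝ) (x : Fin nx ⊕ Fin mx → ℝ) (η : EReal) (ud : Fin mu → ℕ)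
    (π : Fin ky → ℝ) : Prop :=
  ∃ uc ut lam y, (uc, ut, lam) ∈ P.KKT M x ud π ∧ P.RecourseRows x ud uc ut y ∧
    ((P.c₂ ⬝ᵥ y : ℝ) : EReal) - uDot ut ≤ η

/-- The feasibility cutting set of the pair `(u_d, γ)` is satisfied by `x` for suitable values of
its auxiliary variables. -/
def FeasibilityCut (M : ℝ) (x : Fin nx ⊕ Fin mx → ℝ) (ud : Fin mu → ℕ)
    (γ : Fin ky → ℝ) : Prop :=
  ∃ vc vt zet y, (vc, vt, zet) ∈ P.KKT M x ud γ ∧ P.RecourseRows x ud vc vt y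

/-- `(x, η)` is feasible in the master problem built on the set `O` of pairs `(u_d, π)` and the set
`F` of pairs `(u_d, γ)`.  The variable `η` may be `-∞`, which is how the master problem is read
while no optimality cutting set is effective at `x`. The penalty coefficient `M` may vary
with `x`. -/
def MasterFeasible (M : (Fin nx ⊕ Fin mx → ℝ) → ℝ)
    (O F : Set ((Fin mu → ℕ) × (Fin ky → ℝ)))
    (x : Fin nx ⊕ Fin mx → ℝ) (η : EReal) : Prop :=
  x ∈ P.X ∧ η < ⊤ ∧ (∀ p ∈ O, P.OptimalityCut (M x) x η p.1 p.2) ∧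
    ∀ p ∈ F, P.FeasibilityCut (M x) x p.1 p.2

/-- `(x, η)` is (the relevant part of) an optimal solution of the master problem. -/
def MasterOptimal (M : (Fin nx ⊕ Fin mx → ℝ) → ℝ)
    (O F : Set ((Fin mu → ℕ) × (Fin ky → ℝ)))
    (x : Fin nx ⊕ Fin mx → ℝ) (η : EReal) : Prop :=
  P.MasterFeasible M O F x η ∧ ∀ x' η', P.MasterFeasible M O F x' η' →
    ((P.c₁ ⬝ᵥ x : ℝ) : EReal) + η ≤ ((P.c₁ ⬝ᵥ x' : ℝ) : EReal) + η'

/-- The master problem is infeasible. -/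
def MasterInfeasible (M : (Fin nx ⊕ Fin mx → ℝ) → ℝ)
    (O F : Set ((Fin mu → ℕ) × (Fin ky → ℝ))) : Prop :=
  ∀ x η, ¬ P.MasterFeasible M O F x η

/-! ### The subproblems -/

/-- The least total violation `min {1ᵀ ỹ : B₂ y + ỹ ≥ d - B₁ x - E u, y ≥ 0, ỹ ≥ 0}`. -/
def violation (x : Fin nx ⊕ Fin mx → ℝ) (u : (Fin nu → ℝ) × (Fin mu → ℕ)) : EReal :=
  ⨅ q ∈ {q : (Fin ny → ℝ) × (Fin ky → ℝ) |
    0 ≤ q.1 ∧ 0 ≤ q.2 ∧ P.yRhs x u ≤ P.B₂ *ᵥ q.1 + q.2}, ((∑ i, q.2 i : ℝ) : EReal)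

/-- The optimal value `η_f(x)` of `SP1`. -/
def etaF (x : Fin nx ⊕ Fin mx → ℝ) : EReal := ⨆ u ∈ P.U x, P.violation x u

/-- `u` is an optimal solution of `SP1` at `x`. -/
def SP1Optimal (x : Fin nx ⊕ Fin mx → ℝ) (u : (Fin nu → ℝ) × (Fin mu → ℕ)) : Prop :=
  u ∈ P.U x ∧ P.violation x u = P.etaF x

/-- `u` is an optimal solution of `SP2` at `x`, and the extreme point `π` of `Π` is an optimal
solution of the dual of the recourse problem at `(x, u)`. -/
def SP2Optimal (x : Fin nx ⊕ Fin mx → ℝ) (u : (Fin nu → ℝ) × (Fin mu → ℕ))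
    (π : Fin ky → ℝ) : Prop :=
  u ∈ P.U x ∧ P.recourseValue x u = P.etaO x ∧
    π ∈ P.dualPoints ∧ ∀ π' ∈ P.dualSet, P.yRhs x u ⬝ᵥ π' ≤ P.yRhs x u ⬝ᵥ π

/-- `γ` is an extreme ray of `Π` along which the dual `SP3` of the recourse problem at `(x, u)`
goes to infinity. -/
def SP3Ray (x : Fin nx ⊕ Fin mx → ℝ) (u : (Fin nu → ℝ) × (Fin mu → ℕ))
    (γ : Fin ky → ℝ) : Prop :=
  γ ∈ P.dualRays ∧ 0 < P.yRhs x u ⬝ᵥ γ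

end Data

/-! ### The algorithm, with zero tolerance and no initial pairs -/

/-- What the subproblems of one iteration generate: a pair `(u_od, π)` in Case A or a pair
`(u_fd, γ)` in Case B. -/
inductive Generated (mu ky : ℕ) where
  | caseA (ud : Fin mu → ℕ) (π : Fin ky → ℝ)
  | caseB (ud : Fin mu → ℕ) (γ : Fin ky → ℝ)

/-- The state of the algorithm between two iterations: the pairs `(u_od, π)` and `(u_fd, γ)`
stored so far, the two bounds, and the first-stage decision that attains the upper bound. -/
structure State (nx mx mu ky : ℕ) where
  O : Set ((Fin mu → ℕ) × (Fin ky → ℝ))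
  F : Set ((Fin mu → ℕ) × (Fin ky → ℝ))
  LB : EReal
  UB : EReal
  incumbent : Option (Fin nx ⊕ Fin mx → ℝ)

/-- Step 1. -/
def State.initial (nx mx mu ky : ℕ) : State nx mx mu ky := ⟨∅, ∅, ⊥, ⊤, none⟩

/-- The stopping test `UB - LB ≤ 0` of Step 6. -/
def State.Stops (s : State nx mx mu ky) : Prop := s.UB - s.LB ≤ 0

/-- The algorithm terminates in state `s` by the stopping test and returns `x`. -/
def State.Returns (s : State nx mx mu ky) (x : Fin nx ⊕ Fin mx → ℝ) : Prop :=
  s.Stops ∧ s.incumbent = some x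

/-- The generated pair is already stored. -/
def State.Knows (s : State nx mx mu ky) : Generated mu ky → Prop
  | .caseA ud π => (ud, π) ∈ s.O
  | .caseB ud γ => (ud, γ) ∈ s.F

namespace Data

variable (P : Data nx mx nu mu ny kx ku ky)

/-- Steps 3 and 4: at the master solution `x`, the subproblems may generate `g`. -/
def Subproblems (x : Fin nx ⊕ Fin mx → ℝ) : Generated mu ky → Prop
  | .caseA ud π => P.etaF x = 0 ∧ ∃ uc, P.SP2Optimal x (uc, ud) π
  | .caseB ud γ => 0 < P.etaF x ∧ ∃ uc, P.SP1Optimal x (uc, ud) ∧ P.SP3Ray x (uc, ud) γ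

/-- The value of `η_o(x)` used in Step 5: computed in Case A, set to `+∞` in Case B. -/
def computedEta (x : Fin nx ⊕ Fin mx → ℝ) : Generated mu ky → EReal
  | .caseA _ _ => P.etaO x
  | .caseB _ _ => ⊤

/-- The state after an iteration with master solution `(x, η)` and generated pair `g`: the pair
is stored, `LB` is the master value, and `UB` and the decision attaining it are updated. -/
def next (s : State nx mx mu ky) (x : Fin nx ⊕ Fin mx → ℝ) (η : EReal) (g : Generated mu ky) :
    State nx mx mu ky where
  O := match g with
    | .caseA ud π => s.O ∪ {(ud, π)}
    | .caseB _ _ => s.O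
  F := match g with
    | .caseA _ _ => s.F
    | .caseB ud γ => s.F ∪ {(ud, γ)}
  LB := ((P.c₁ ⬝ᵥ x : ℝ) : EReal) + η
  UB := min s.UB (((P.c₁ ⬝ᵥ x : ℝ) : EReal) + P.computedEta x g)
  incumbent :=
    if ((P.c₁ ⬝ᵥ x : ℝ) : EReal) + P.computedEta x g ≤ s.UB then some x else s.incumbent

/-- `(x, η)` and `g` are possible results of Steps 2-4 in an iteration started from `s`. -/
def Iteration (M : (Fin nx ⊕ Fin mx → ℝ) → ℝ) (s : State nx mx mu ky)
    (x : Fin nx ⊕ Fin mx → ℝ) (η : EReal) (g : Generated mu ky) : Prop :=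
  P.MasterOptimal M s.O s.F x η ∧ P.Subproblems x g

/-- `Run M n s`: some execution of the algorithm is in state `s` after `n` iterations, each of the
earlier ones having failed the stopping test. -/
inductive Run (M : (Fin nx ⊕ Fin mx → ℝ) → ℝ) : ℕ → State nx mx mu ky → Prop
  | start : Run M 0 (State.initial nx mx mu ky)
  | iterate {n : ℕ} {s : State nx mx mu ky} {x : Fin nx ⊕ Fin mx → ℝ} {η : EReal}
      {g : Generated mu ky} (hrun : Run M n s) (hgo : ¬ s.Stops) (hit : P.Iteration M s x η g) :
      Run M (n + 1) (P.next s x η g)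

/-- The algorithm terminates in state `s` by reporting that the two-stage program is infeasible. -/
def ReportsInfeasible (M : (Fin nx ⊕ Fin mx → ℝ) → ℝ) (s : State nx mx mu ky) : Prop :=
  ¬ s.Stops ∧ P.MasterInfeasible M s.O s.F

end Data

end TwoStageRO

end

/-! A cutting set asks for a KKT point of a penalized linear program instead of a fixed scenario.
The penalty is exact. The dual polyhedron of the unpenalized program does not depend on the
right-hand side, and it is nonempty because a nonempty bounded `U x` forces a trivial recession cone
of `Fc x`. Its finitely many extreme points therefore bound some optimal dual solution uniformly.
Beyond that bound KKT points always exist, and they have zero slack whenever the unpenalized program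
is feasible (`exists_exactPenalty`).

Two consequences carry the theorem. First, every feasible first-stage decision with its true
worst-case cost satisfies all cuts (`masterFeasible_of_firstStageFeasible`): a KKT point with zero
slack is a real scenario, and nonzero slack switches the cut off. Hence the master problem is a
relaxation, `LB` never exceeds the optimal value, and an infeasible master problem proves
infeasibility.

Second, suppose the subproblem at the master solution returns a stored pair. The stored cut then
exhibits a scenario with the same discrete part that is at least as bad along the same dual vector
(`KKT_exact`). For an extreme ray this contradicts the feasibility of that scenario's recourse
problem; for an extreme point it gives `etaO` at most `η`, so the bounds meet. As `Ud`, the extreme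
points and the extreme rays are finite, the number of iterations is bounded. Solvability of the
subproblems is compactness of `U x` together with linear programming duality. -/

noncomputable section

namespace TwoStageRO

/-! ### Linear programming -/

/-- **Farkas' lemma** for finitely many linear functionals on a real vector space. -/
theorem farkas_functionals {V ι : Type*} [AddCommGroup V] [Module ℝ V] (s : Finset ι)
    (f : ι → V →ₗ[ℝ] ℝ) (g : V →ₗ[ℝ] ℝ) :
    (∃ w : ι → ℝ, 0 ≤ w ∧ g = ∑ i ∈ s, w i • f i) ∨
      ∃ v, (∀ i ∈ s, 0 ≤ f i v) ∧ g v < 0 := by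
  classical
  induction s using Finset.induction_on generalizing f g with
  | empty =>
    by_cases hg : g = 0
    · exact Or.inl ⟨0, le_rfl, by simp [hg]⟩
    · obtain ⟨v, hv⟩ : ∃ v, g v ≠ 0 := by
        by_contra! h
        exact hg (LinearMap.ext h)
      rcases lt_or_gt_of_ne hv with h | h
      · exact Or.inr ⟨v, by simp, h⟩
      · exact Or.inr ⟨-v, by simp, by simpa using h⟩
  | insert a s ha ih =>
    rcases ih f g with ⟨w, hw, hg⟩ | ⟨v, hv, hgv⟩
    · refine Or.inl ⟨Function.update w a 0, ?_, ?_⟩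
      · intro i
        by_cases h : i = a
        · subst h; simp
        · simpa [h] using hw i
      · rw [Finset.sum_insert ha, hg]
        simp only [Function.update_self, zero_smul, zero_add]
        refine Finset.sum_congr rfl fun i hi => ?_
        rw [Function.update_of_ne (ne_of_mem_of_not_mem hi ha)]
    by_cases hav : 0 ≤ f a v
    · refine Or.inr ⟨v, ?_, hgv⟩
      simpa [hav] using hv
    push Not at hav
    obtain ⟨v, hv, hgv, hav⟩ : ∃ v, (∀ i ∈ s, 0 ≤ f i v) ∧ g v < 0 ∧ f a v = -1 := by
      have h : 0 < (-(f a v))⁻¹ := inv_pos.2 (by linarith)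
      refine ⟨(-(f a v))⁻¹ • v, fun i hi => ?_, ?_, ?_⟩
      · simpa using mul_nonneg h.le (hv i hi)
      · simpa using mul_neg_of_pos_of_neg h hgv
      · have : f a v ≠ 0 := hav.ne
        simp only [map_smul, smul_eq_mul]
        field_simp
    -- Since `f a v = -1`, each modified functional vanishes on `v`; this eliminates the direction
    -- `v`. Weights found for them become weights for the original ones by giving `a` the weight `∑
    -- w i * f i v - g v`, nonnegative because `g v < 0`. A separating `u` is shifted along `v`
    -- until `f a` vanishes on it.
    rcases ih (fun i => f i + f i v • f a) (g + g v • f a) with ⟨w, hw, hg⟩ | ⟨u, hu, hgu⟩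
    · refine Or.inl ⟨Function.update w a (∑ i ∈ s, w i * f i v - g v), ?_, ?_⟩
      · intro i
        by_cases h : i = a
        · subst h
          have : 0 ≤ ∑ j ∈ s, w j * f j v :=
            Finset.sum_nonneg fun j hj => mul_nonneg (hw j) (hv j hj)
          simp only [Pi.zero_apply, Function.update_self]
          linarith
        · simpa [h] using hw i
      · rw [Finset.sum_insert ha, Function.update_self]
        have h1 : ∑ i ∈ s, Function.update w a (∑ i ∈ s, w i * f i v - g v) i • f i
            = ∑ i ∈ s, w i • f i := by
          refine Finset.sum_congr rfl fun i hi => ?_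
          rw [Function.update_of_ne (ne_of_mem_of_not_mem hi ha)]
        simp only [smul_add, Finset.sum_add_distrib, smul_smul, ← Finset.sum_smul] at hg
        ext z
        have h2 := LinearMap.congr_fun hg z
        rw [h1]
        simp only [LinearMap.add_apply, LinearMap.smul_apply, smul_eq_mul] at h2 ⊢
        linarith
    · refine Or.inr ⟨u + f a u • v, ?_, ?_⟩
      · intro i hi
        rcases Finset.mem_insert.1 hi with rfl | hi
        · simp [hav]
        · have := hu i hi
          simp only [LinearMap.add_apply, LinearMap.smul_apply, smul_eq_mul, map_add,
            map_smul] at this ⊢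
          linarith
      · simp only [LinearMap.add_apply, LinearMap.smul_apply, smul_eq_mul, map_add,
          map_smul] at hgu ⊢
        linarith

section Matrix

variable {m n : Type*} [Fintype m] [Fintype n]

theorem dotProduct_mulVec_transpose (A : Matrix m n ℝ) (x : n → ℝ) (y : m → ℝ) :
    x ⬝ᵥ Aᵀ *ᵥ y = y ⬝ᵥ A *ᵥ x := by
  rw [Matrix.mulVec_transpose, dotProduct_comm, Matrix.dotProduct_mulVec]

/-- **Farkas' lemma** for a system of inequalities in nonnegative variables. -/
theorem farkas (A : Matrix m n ℝ) (b : m → ℝ) :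
    (∃ x, 0 ≤ x ∧ A *ᵥ x ≤ b) ∨ ∃ y, 0 ≤ y ∧ 0 ≤ Aᵀ *ᵥ y ∧ b ⬝ᵥ y < 0 := by
  classical
  -- In a representation of `b` by these functionals, the weights on the columns of `A` form the
  -- solution `x`, and those on the coordinates form the slack of `A *ᵥ x ≤ b`.
  let F : m ⊕ n → (m → ℝ) →ₗ[ℝ] ℝ := Sum.elim (fun i => LinearMap.proj i)
    (fun j => (LinearMap.proj j).comp (Matrix.mulVecLin Aᵀ))
  let g : (m → ℝ) →ₗ[ℝ] ℝ := dotProductBilin ℝ ℝ b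
  have hg : ∀ y, g y = b ⬝ᵥ y := fun y => rfl
  rcases farkas_functionals Finset.univ F g with ⟨w, hw, h⟩ | ⟨y, hy, h⟩
  · refine Or.inl ⟨fun j => w (Sum.inr j), fun j => hw _, fun i => ?_⟩
    have h1 := congrArg (fun k => k (Pi.single i 1)) h
    simp only [hg, Fintype.sum_sum_type, LinearMap.add_apply, LinearMap.sum_apply,
      LinearMap.smul_apply] at h1
    have h2 : ∀ j, (F (Sum.inr j)) (Pi.single i 1) = A i j := by
      intro j
      simp [F]
    have h3 : ∀ k, (F (Sum.inl k)) (Pi.single i 1) = if k = i then 1 else 0 := by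
      intro k
      simp [F, Pi.single_apply]
    simp only [h2, h3, dotProduct_single, mul_one, smul_eq_mul, mul_ite, mul_zero,
      Finset.sum_ite_eq', Finset.mem_univ, if_true] at h1
    have h4 : (A *ᵥ fun j => w (Sum.inr j)) i = ∑ j, w (Sum.inr j) * A i j := by
      simp [Matrix.mulVec, dotProduct, mul_comm]
    have h5 := hw (Sum.inl i)
    simp only [Pi.zero_apply] at h5
    linarith
  · exact Or.inr ⟨y, fun i => hy (Sum.inl i) (Finset.mem_univ _),
      fun j => hy (Sum.inr j) (Finset.mem_univ _), h⟩

theorem weak_duality {A : Matrix m n ℝ} {b : m → ℝ} {c x : n → ℝ} {y : m → ℝ}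
    (hx : 0 ≤ x) (hAx : A *ᵥ x ≤ b) (hy : 0 ≤ y) (hAy : c ≤ Aᵀ *ᵥ y) : c ⬝ᵥ x ≤ b ⬝ᵥ y :=
  calc c ⬝ᵥ x = x ⬝ᵥ c := dotProduct_comm _ _
    _ ≤ x ⬝ᵥ Aᵀ *ᵥ y := dotProduct_le_dotProduct_of_nonneg_left hAy hx
    _ = y ⬝ᵥ A *ᵥ x := dotProduct_mulVec_transpose A x y
    _ ≤ y ⬝ᵥ b := dotProduct_le_dotProduct_of_nonneg_left hAx hy
    _ = b ⬝ᵥ y := dotProduct_comm _ _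

/-- **Strong duality** of linear programming, with attainment on both sides. -/
theorem strong_duality (A : Matrix m n ℝ) (b : m → ℝ) (c : n → ℝ)
    (hp : ∃ x, 0 ≤ x ∧ A *ᵥ x ≤ b) (hd : ∃ y, 0 ≤ y ∧ c ≤ Aᵀ *ᵥ y) :
    ∃ x y, 0 ≤ x ∧ A *ᵥ x ≤ b ∧ 0 ≤ y ∧ c ≤ Aᵀ *ᵥ y ∧ c ⬝ᵥ x = b ⬝ᵥ y := by
  classical
  -- One system combines primal feasibility, dual feasibility and the reversed inequality `b ⬝ᵥ y ≤
  -- c ⬝ᵥ x`. In the Farkas alternative, `t` is the multiplier of that last row.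
  rcases farkas (Matrix.fromRows (Matrix.fromBlocks A 0 0 (-Aᵀ))
    (Matrix.replicateRow Unit (Sum.elim (-c) b)))
    (Sum.elim (Sum.elim b (-c)) (0 : Unit → ℝ)) with ⟨z, hz, h⟩ | ⟨z, hz, h, hlt⟩
  · obtain ⟨x, y, rfl⟩ : ∃ x y, z = Sum.elim x y := ⟨_, _, (Sum.elim_comp_inl_inr z).symm⟩
    have hx : 0 ≤ x := fun i => hz (Sum.inl i)
    have hy : 0 ≤ y := fun i => hz (Sum.inr i)
    have h1 : A *ᵥ x ≤ b := fun i => by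
      simpa [Matrix.fromBlocks_mulVec] using h (Sum.inl (Sum.inl i))
    have h2 : c ≤ Aᵀ *ᵥ y := fun i => by
      simpa [Matrix.fromBlocks_mulVec, Matrix.neg_mulVec] using h (Sum.inl (Sum.inr i))
    have h3 : -(c ⬝ᵥ x) + b ⬝ᵥ y ≤ 0 := by
      simpa [Matrix.mulVec, Matrix.replicateRow, dotProduct, Fintype.sum_sum_type] using
        h (Sum.inr ())
    exact ⟨x, y, hx, h1, hy, h2, le_antisymm (weak_duality hx h1 hy h2) (by linarith)⟩
  · exfalso
    obtain ⟨y, x, t, rfl⟩ : ∃ (y : m → ℝ) (x : n → ℝ) (t : ℝ),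
        z = Sum.elim (Sum.elim y x) (fun _ => t) :=
      ⟨fun i => z (Sum.inl (Sum.inl i)), fun i => z (Sum.inl (Sum.inr i)), z (Sum.inr ()), by
        ext ((i | i) | i) <;> rfl⟩
    have hy : 0 ≤ y := fun i => hz (Sum.inl (Sum.inl i))
    have hx : 0 ≤ x := fun i => hz (Sum.inl (Sum.inr i))
    have ht : 0 ≤ t := hz (Sum.inr ())
    have h1 : t • c ≤ Aᵀ *ᵥ y := fun i => by
      have := h (Sum.inl i)
      simp [Matrix.transpose_fromRows, Matrix.fromBlocks_transpose, Matrix.fromCols_mulVec,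
        Matrix.fromBlocks_mulVec] at this
      simp [Matrix.mulVec, dotProduct] at this ⊢
      linarith
    have h2 : A *ᵥ x ≤ t • b := fun i => by
      have := h (Sum.inr i)
      simp [Matrix.transpose_fromRows, Matrix.fromBlocks_transpose, Matrix.fromCols_mulVec,
        Matrix.fromBlocks_mulVec, Matrix.neg_mulVec] at this
      simp [Matrix.mulVec, dotProduct] at this ⊢
      linarith
    have h3 : b ⬝ᵥ y < c ⬝ᵥ x := by
      simpa [dotProduct, Fintype.sum_sum_type] using hlt
    -- For `t = 0` the multipliers are recession directions, and pairing them with the given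
    -- feasible points yields a contradiction. For `t > 0`, division by `t` gives a feasible pair
    -- violating weak duality.
    rcases ht.eq_or_lt with rfl | ht
    · obtain ⟨x₀, hx₀, hAx₀⟩ := hp
      obtain ⟨y₀, hy₀, hAy₀⟩ := hd
      have h4 := weak_duality hx₀ hAx₀ hy h1
      have h5 := weak_duality hx h2 hy₀ hAy₀
      simp at h4 h5
      linarith
    · have h4 : c ⬝ᵥ (t⁻¹ • x) ≤ b ⬝ᵥ (t⁻¹ • y) := by
        refine weak_duality (A := A) (smul_nonneg (inv_pos.2 ht).le hx) ?_
          (smul_nonneg (inv_pos.2 ht).le hy) ?_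
        · rw [Matrix.mulVec_smul, inv_smul_le_iff_of_pos ht]
          exact h2
        · rw [Matrix.mulVec_smul, le_inv_smul_iff_of_pos ht]
          exact h1
      simp only [dotProduct_smul, smul_eq_mul] at h4
      exact absurd (le_of_mul_le_mul_left h4 (inv_pos.2 ht)) (not_le.2 h3)

end Matrix

/-! ### Extreme points of polyhedra -/

/-- A polyhedron has only finitely many extreme points. -/
theorem finite_extremePoints_polyhedron {E ι : Type*} [AddCommGroup E] [Module ℝ E] [Finite ι]
    (f : ι → E →ₗ[ℝ] ℝ) (b : ι → ℝ) :
    (Set.extremePoints ℝ {x : E | ∀ i, f i x ≤ b i}).Finite := by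
  classical
  cases nonempty_fintype ι
  -- An extreme point is determined by its set of active constraints.
  refine Set.Finite.of_injOn (f := fun x => {i | f i x = b i}) (t := Set.univ)
    (fun _ _ => Set.mem_univ _) ?_ Set.finite_univ
  intro x hx y hy hxy
  by_contra hne
  have hact : ∀ i, f i x = b i → f i y = b i := fun i hi => by
    have := (Set.ext_iff.1 hxy i).1 hi
    exact this
  have hx' : ∀ i, f i x ≤ b i := hx.1
  -- Constraints active at `x` are active at `y` too, so moving along `x - y` keeps them tight; the
  -- others have room for a small step either way. Thus `x` would be the midpoint of a segment in
  -- the polyhedron.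
  obtain ⟨ε, hε, h⟩ : ∃ ε : ℝ, 0 < ε ∧ ∀ i, |ε * (f i x - f i y)| ≤ b i - f i x := by
    have h1 : ∀ i, ∀ᶠ ε in nhdsWithin (0 : ℝ) (Set.Ioi 0),
        |ε * (f i x - f i y)| ≤ b i - f i x := by
      intro i
      by_cases hi : f i x = b i
      · simp [hi, hact i hi]
      · have hpos : 0 < b i - f i x := sub_pos.2 (lt_of_le_of_ne (hx' i) hi)
        have hc : Filter.Tendsto (fun ε : ℝ => |ε * (f i x - f i y)|)
            (nhdsWithin 0 (Set.Ioi 0)) (nhds 0) := by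
          have : Continuous (fun ε : ℝ => |ε * (f i x - f i y)|) := by fun_prop
          simpa using (this.tendsto 0).mono_left nhdsWithin_le_nhds
        exact (hc.eventually (gt_mem_nhds hpos)).mono fun ε h => le_of_lt h
    obtain ⟨ε, h2, h3⟩ := ((Filter.eventually_all.2 h1).and self_mem_nhdsWithin).exists
    exact ⟨ε, h3, h2⟩
  have hmem := hx.2 (x₁ := x + ε • (x - y)) ?_ (x₂ := x - ε • (x - y)) ?_ ?_
  · have : ε • (x - y) = 0 := by simpa using hmem
    rcases smul_eq_zero.1 this with h | h
    · exact hε.ne' h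
    · exact hne (sub_eq_zero.1 h)
  · intro i
    have := (abs_le.1 (h i)).2
    simp only [map_add, map_smul, map_sub, smul_eq_mul]
    linarith
  · intro i
    have := (abs_le.1 (h i)).1
    simp only [map_sub, map_smul, smul_eq_mul]
    linarith
  · refine ⟨1 / 2, 1 / 2, by norm_num, by norm_num, by norm_num, ?_⟩
    module

/-! ### Extreme points of closed sets in the nonnegative orthant. -/

section Orthant

variable {m n : Type*} [Fintype n]

theorem finite_extremePoints_nonneg_mulVec_le [Finite m] (A : Matrix m n ℝ) (b : m → ℝ) :
    (Set.extremePoints ℝ {x : n → ℝ | 0 ≤ x ∧ A *ᵥ x ≤ b}).Finite := by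
  have h : {x : n → ℝ | 0 ≤ x ∧ A *ᵥ x ≤ b} = {x | ∀ k,
      (Sum.elim (fun i => -LinearMap.proj i) (fun j => (LinearMap.proj j).comp A.mulVecLin) :
        n ⊕ m → (n → ℝ) →ₗ[ℝ] ℝ) k x ≤ (Sum.elim 0 b : n ⊕ m → ℝ) k} := by
    ext x
    simp [Pi.le_def]
  rw [h]
  exact finite_extremePoints_polyhedron _ _

theorem isClosed_nonneg_mulVec_le (A : Matrix m n ℝ) (b : m → ℝ) :
    IsClosed {x : n → ℝ | 0 ≤ x ∧ A *ᵥ x ≤ b} :=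
  IsClosed.inter (s₁ := {x | 0 ≤ x}) (s₂ := {x | A *ᵥ x ≤ b})
    (isClosed_le continuous_const continuous_id)
    (isClosed_le (Continuous.matrix_mulVec continuous_const continuous_id) continuous_const)

theorem isCompact_of_nonneg_of_sum_le {S : Set (n → ℝ)} (hS : IsClosed S) {C : ℝ}
    (h0 : ∀ x ∈ S, 0 ≤ x) (hC : ∀ x ∈ S, ∑ i, x i ≤ C) : IsCompact S := by
  refine IsCompact.of_isClosed_subset (isCompact_Icc (a := (0 : n → ℝ)) (b := fun _ => C)) hS ?_
  refine fun x hx => ⟨h0 x hx, fun i => ?_⟩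
  exact (Finset.single_le_sum (fun j _ => h0 x hx j) (Finset.mem_univ i)).trans (hC x hx)

/-- A nonempty closed subset of the nonnegative orthant has an extreme point. -/
theorem extremePoints_nonempty_of_nonneg {S : Set (n → ℝ)} (hS : IsClosed S) (hne : S.Nonempty)
    (h0 : ∀ x ∈ S, 0 ≤ x) : (S.extremePoints ℝ).Nonempty := by
  -- Minimizing the coordinate sum exposes a face that is compact even when `S` is unbounded. An
  -- extreme point of this face is extreme in `S`.
  let l : StrongDual ℝ (n → ℝ) := -∑ i, ContinuousLinearMap.proj i
  have hl : ∀ x, l x = -∑ i, x i := fun x => by simp [l]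
  obtain ⟨x₀, hx₀⟩ := hne
  have hsum : Continuous fun x : n → ℝ => ∑ i, x i := by fun_prop
  have hc : IsCompact (S ∩ {x | ∑ i, x i ≤ ∑ i, x₀ i}) :=
    isCompact_of_nonneg_of_sum_le (hS.inter (isClosed_le hsum continuous_const))
      (fun x hx => h0 x hx.1) (fun x hx => hx.2)
  obtain ⟨x₁, hx₁, hmin⟩ := hc.exists_isMinOn ⟨x₀, hx₀, le_refl (∑ i, x₀ i)⟩ hsum.continuousOn
  have hmin' : ∀ y ∈ S, ∑ i, x₁ i ≤ ∑ i, y i := by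
    intro y hy
    by_cases h : ∑ i, y i ≤ ∑ i, x₀ i
    · exact hmin ⟨hy, h⟩
    · exact hx₁.2.trans (not_le.1 h).le
  have hexp : IsExposed ℝ S (l.toExposed S) := ContinuousLinearMap.toExposed.isExposed
  have hx₁' : x₁ ∈ l.toExposed S := ⟨hx₁.1, fun y hy => by simpa [hl] using hmin' y hy⟩
  have hcomp : IsCompact (l.toExposed S) := by
    refine isCompact_of_nonneg_of_sum_le (hexp.isClosed hS) (C := ∑ i, x₁ i)
      (fun x hx => h0 x hx.1) (fun x hx => ?_)
    simpa [hl] using hx.2 x₁ hx₁.1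
  obtain ⟨x, hx⟩ := hcomp.extremePoints_nonempty ⟨x₁, hx₁'⟩
  exact ⟨x, hexp.isExtreme.extremePoints_subset_extremePoints hx⟩

/-- A linear functional that attains its maximum over a closed subset of the nonnegative orthant
attains it at an extreme point. -/
theorem exists_extremePoint_isMax {S : Set (n → ℝ)} (hS : IsClosed S) (h0 : ∀ x ∈ S, 0 ≤ x)
    (r : n → ℝ) {x₀ : n → ℝ} (hx₀ : x₀ ∈ S) (hmax : ∀ y ∈ S, r ⬝ᵥ y ≤ r ⬝ᵥ x₀) :
    ∃ x ∈ S.extremePoints ℝ, r ⬝ᵥ x = r ⬝ᵥ x₀ := by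
  let l : StrongDual ℝ (n → ℝ) := ∑ i, r i • ContinuousLinearMap.proj i
  have hl : ∀ x, l x = r ⬝ᵥ x := fun x => by simp [l, dotProduct]
  have hexp : IsExposed ℝ S (l.toExposed S) := ContinuousLinearMap.toExposed.isExposed
  obtain ⟨x, hx⟩ := extremePoints_nonempty_of_nonneg (hexp.isClosed hS)
    ⟨x₀, hx₀, fun y hy => by simpa [hl] using hmax y hy⟩ (fun x hx => h0 x hx.1)
  have h1 := hx.1.2 x₀ hx₀
  rw [hl, hl] at h1
  exact ⟨x, hexp.isExtreme.extremePoints_subset_extremePoints hx,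
    le_antisymm (hmax x hx.1.1) h1⟩

end Orthant

/-! ### Exact penalties -/

section Penalty

variable {m n : Type*} [Fintype m] [Fintype n]

theorem mul_eq_zero_of_dotProduct_eq_zero {x y : n → ℝ} (hx : 0 ≤ x) (hy : 0 ≤ y)
    (h : x ⬝ᵥ y = 0) (i : n) : x i * y i = 0 :=
  (Finset.sum_eq_zero_iff_of_nonneg fun i _ => mul_nonneg (hx i) (hy i)).1 h i (Finset.mem_univ i)

/-- The duality gap is the sum of the two nonnegative products `y ⬝ᵥ (b - A *ᵥ x)` and `x ⬝ᵥ (Aᵀ *ᵥ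
y - c)`, so a zero gap makes each of them vanish termwise. -/
theorem complementary_slackness {A : Matrix m n ℝ} {b : m → ℝ} {c x : n → ℝ} {y : m → ℝ}
    (hx : 0 ≤ x) (hAx : A *ᵥ x ≤ b) (hy : 0 ≤ y) (hAy : c ≤ Aᵀ *ᵥ y) (h : c ⬝ᵥ x = b ⬝ᵥ y) :
    (∀ i, y i * (b - A *ᵥ x) i = 0) ∧ ∀ j, x j * (Aᵀ *ᵥ y - c) j = 0 := by
  have h1 : 0 ≤ y ⬝ᵥ (b - A *ᵥ x) := dotProduct_nonneg_of_nonneg hy (sub_nonneg.2 hAx)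
  have h2 : 0 ≤ x ⬝ᵥ (Aᵀ *ᵥ y - c) := dotProduct_nonneg_of_nonneg hx (sub_nonneg.2 hAy)
  have h3 : y ⬝ᵥ (b - A *ᵥ x) + x ⬝ᵥ (Aᵀ *ᵥ y - c) = 0 := by
    rw [dotProduct_sub, dotProduct_sub, dotProduct_mulVec_transpose, dotProduct_comm y b,
      dotProduct_comm x c]
    linarith
  exact ⟨mul_eq_zero_of_dotProduct_eq_zero hy (sub_nonneg.2 hAx) (by linarith),
    mul_eq_zero_of_dotProduct_eq_zero hx (sub_nonneg.2 hAy) (by linarith)⟩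

/-- If `{u ≥ 0 : F u ≤ b}` has a trivial recession cone, the linear programs
`max {v u : F u ≤ b, u ≥ 0}` that are feasible have dual optimal solutions bounded uniformly in
the right-hand side. -/
theorem exists_dual_bound (F : Matrix m n ℝ) (hF : ∀ u, 0 ≤ u → F *ᵥ u ≤ 0 → u = 0)
    (v : n → ℝ) :
    ∃ K : ℝ, ∀ b, (∃ u, 0 ≤ u ∧ F *ᵥ u ≤ b) → ∃ u l, 0 ≤ u ∧ F *ᵥ u ≤ b ∧ 0 ≤ l ∧
      v ≤ Fᵀ *ᵥ l ∧ v ⬝ᵥ u = b ⬝ᵥ l ∧ ∀ i, l i < K := by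
  -- The dual feasible set does not involve `b`, so one bound on its finitely many extreme points
  -- serves all right-hand sides.
  let S : Set (m → ℝ) := {l | 0 ≤ l ∧ -Fᵀ *ᵥ l ≤ -v}
  have hS : ∀ l, -Fᵀ *ᵥ l ≤ -v ↔ v ≤ Fᵀ *ᵥ l := fun l => by
    rw [Matrix.neg_mulVec, neg_le_neg_iff]
  have hSfin : (S.extremePoints ℝ).Finite := finite_extremePoints_nonneg_mulVec_le _ _
  have hSne : ∃ l, 0 ≤ l ∧ v ≤ Fᵀ *ᵥ l := by
    -- A certificate of dual infeasibility would be a nonzero recession direction, which `hF`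
    -- excludes.
    rcases farkas (-Fᵀ) (-v) with ⟨l, hl, h⟩ | ⟨u, hu, h, hlt⟩
    · exact ⟨l, hl, (hS l).1 h⟩
    · have := hF u hu (by simpa [Matrix.neg_mulVec] using h)
      simp [this] at hlt
  obtain ⟨K, hK⟩ : ∃ K : ℝ, ∀ l ∈ S.extremePoints ℝ, ∀ i, l i < K := by
    have h : (⋃ l ∈ S.extremePoints ℝ, Set.range l).Finite :=
      hSfin.biUnion fun l _ => Set.finite_range l
    obtain ⟨K, hK⟩ := h.bddAbove
    -- The extra 1 makes the bound strict, which is what later forces the penalized slack to be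
    -- zero.
    refine ⟨K + 1, fun l hl i => ?_⟩
    have := hK (Set.mem_biUnion hl (Set.mem_range_self i))
    linarith
  refine ⟨K, fun b hb => ?_⟩
  obtain ⟨u, l, hu, hFu, hl, hvl, heq⟩ := strong_duality F b v hb hSne
  have hmax : ∀ l' ∈ S, (-b) ⬝ᵥ l' ≤ (-b) ⬝ᵥ l := by
    intro l' hl'
    have := weak_duality hu hFu hl'.1 ((hS _).1 hl'.2)
    simp only [neg_dotProduct]
    linarith
  obtain ⟨l', hl', he⟩ := exists_extremePoint_isMax (isClosed_nonneg_mulVec_le _ _)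
    (fun _ h => h.1) (-b) (x₀ := l) ⟨hl, (hS _).2 hvl⟩ hmax
  refine ⟨u, l', hu, hFu, hl'.1.1, (hS _).1 hl'.1.2, ?_, hK l' hl'⟩
  simp only [neg_dotProduct] at he
  linarith

/-- The KKT system of `max {v u - M 1ᵀ ũ : F u - ũ ≤ b, u ≥ 0, ũ ≥ 0}`. -/
def penaltyKKT (F : Matrix m n ℝ) (b : m → ℝ) (v : n → ℝ) (M : ℝ) :
    Set ((n → ℝ) × (m → ℝ) × (m → ℝ)) :=
  {z | F *ᵥ z.1 - z.2.1 ≤ b ∧ v ≤ Fᵀ *ᵥ z.2.2 ∧ (∀ i, z.2.2 i ≤ M) ∧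
    (∀ i, z.2.2 i * (b - F *ᵥ z.1 + z.2.1) i = 0) ∧ (∀ j, z.1 j * (Fᵀ *ᵥ z.2.2 - v) j = 0) ∧
    (∀ i, z.2.1 i * (M - z.2.2 i) = 0) ∧ 0 ≤ z.1 ∧ 0 ≤ z.2.1 ∧ 0 ≤ z.2.2}

/-- The penalized program is always feasible, with `0` and the negative part of `b`, and `l₀` is
feasible for its dual, where the penalty becomes the bound `M` on the multipliers. Strong duality
and complementary slackness then supply the KKT point. -/
theorem penaltyKKT_nonempty {F : Matrix m n ℝ} {v : n → ℝ} {M : ℝ} {l₀ : m → ℝ} (hl₀ : 0 ≤ l₀)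
    (hv : v ≤ Fᵀ *ᵥ l₀) (hM : ∀ i, l₀ i ≤ M) (b : m → ℝ) : (penaltyKKT F b v M).Nonempty := by
  classical
  have hd : (Matrix.fromCols F (-1 : Matrix m m ℝ))ᵀ = Matrix.fromRows Fᵀ (-1) := by
    rw [Matrix.transpose_fromCols, Matrix.transpose_neg, Matrix.transpose_one]
  have hp : ∀ u w, Matrix.fromCols F (-1 : Matrix m m ℝ) *ᵥ Sum.elim u w = F *ᵥ u - w := by
    intro u w
    rw [Matrix.fromCols_mulVec_sumElim, Matrix.neg_mulVec, Matrix.one_mulVec, sub_eq_add_neg]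
  have hdm : ∀ l, (Matrix.fromCols F (-1 : Matrix m m ℝ))ᵀ *ᵥ l = Sum.elim (Fᵀ *ᵥ l) (-l) := by
    intro l
    rw [hd, Matrix.fromRows_mulVec, Matrix.neg_mulVec, Matrix.one_mulVec]
  obtain ⟨z, l, hz, hAz, hl, hAl, heq⟩ := strong_duality (Matrix.fromCols F (-1 : Matrix m m ℝ)) b
    (Sum.elim v fun _ => -M)
    ⟨Sum.elim 0 b⁻, by rintro (i | i) <;> simp [negPart_nonneg], by
      rw [hp, Matrix.mulVec_zero, zero_sub]
      exact neg_le.1 (neg_le_negPart b)⟩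
    ⟨l₀, hl₀, by
      rw [hdm]
      rintro (i | i)
      · exact hv i
      · simpa using hM i⟩
  obtain ⟨u, w, rfl⟩ : ∃ u w, z = Sum.elim u w := ⟨_, _, (Sum.elim_comp_inl_inr z).symm⟩
  obtain ⟨h1, h2⟩ := complementary_slackness hz hAz hl hAl heq
  rw [hp] at hAz h1
  rw [hdm] at hAl h2
  refine ⟨(u, w, l), hAz, fun j => hAl (Sum.inl j), fun i => ?_, fun i => ?_,
    fun j => h2 (Sum.inl j), fun i => ?_, fun i => hz (Sum.inl i), fun i => hz (Sum.inr i), hl⟩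
  · simpa using hAl (Sum.inr i)
  · have := h1 i
    rwa [← sub_add] at this
  · have := h2 (Sum.inr i)
    simp only [Sum.elim_inr, Pi.sub_apply, Pi.neg_apply] at this
    linear_combination this

/-- Summing the three families of complementarity equations closes the duality gap. -/
theorem penaltyKKT_objective {F : Matrix m n ℝ} {b : m → ℝ} {v : n → ℝ} {M : ℝ}
    {u : n → ℝ} {w l : m → ℝ} (h : (u, w, l) ∈ penaltyKKT F b v M) :
    v ⬝ᵥ u - M * ∑ i, w i = b ⬝ᵥ l := by
  obtain ⟨-, -, -, h1, h2, h3, -⟩ := h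
  have e1 : l ⬝ᵥ (b - F *ᵥ u + w) = 0 := Finset.sum_eq_zero fun i _ => h1 i
  have e2 : u ⬝ᵥ (Fᵀ *ᵥ l - v) = 0 := Finset.sum_eq_zero fun i _ => h2 i
  have e3 : ∑ i, w i * (M - l i) = 0 := Finset.sum_eq_zero fun i _ => h3 i
  rw [dotProduct_add, dotProduct_sub] at e1
  rw [dotProduct_sub, dotProduct_mulVec_transpose] at e2
  have e4 : ∑ i, w i * (M - l i) = M * ∑ i, w i - l ⬝ᵥ w := by
    simp only [mul_sub, Finset.sum_sub_distrib, dotProduct, Finset.mul_sum]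
    congr 1 <;> exact Finset.sum_congr rfl fun i _ => mul_comm _ _
  rw [dotProduct_comm v, dotProduct_comm b]
  linarith

/-- The penalty is exact once `M` exceeds the entries of a dual optimal solution. -/
theorem eq_zero_of_mem_penaltyKKT {F : Matrix m n ℝ} {b : m → ℝ} {v : n → ℝ} {M : ℝ}
    {u₀ : n → ℝ} {l₀ : m → ℝ} (hu₀ : 0 ≤ u₀) (hFu₀ : F *ᵥ u₀ ≤ b) (hl₀ : 0 ≤ l₀)
    (hvl₀ : v ≤ Fᵀ *ᵥ l₀) (heq : v ⬝ᵥ u₀ = b ⬝ᵥ l₀) (hM : ∀ i, l₀ i < M)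
    {u : n → ℝ} {w l : m → ℝ} (h : (u, w, l) ∈ penaltyKKT F b v M) : w = 0 := by
  have hobj := penaltyKKT_objective h
  obtain ⟨hF, hvl, -, -, -, -, hu, hw, hl⟩ := h
  -- Crossing each primal point with the other dual point bounds `M * ∑ i, w i` by `w ⬝ᵥ l₀`. Since
  -- `w ≥ 0` and every `M - l₀ i` is positive, `w` must vanish.
  have h1 := weak_duality hu₀ hFu₀ hl hvl
  have h2 : v ⬝ᵥ u ≤ (b + w) ⬝ᵥ l₀ := weak_duality hu (sub_le_iff_le_add.1 hF) hl₀ hvl₀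
  rw [add_dotProduct] at h2
  have h3 : M * ∑ i, w i - w ⬝ᵥ l₀ = w ⬝ᵥ (fun i => M - l₀ i) := by
    simp only [mul_sub, Finset.sum_sub_distrib, dotProduct, Finset.mul_sum]
    congr 1
    exact Finset.sum_congr rfl fun i _ => mul_comm _ _
  have hM' : 0 ≤ fun i => M - l₀ i := fun i => (sub_pos.2 (hM i)).le
  have h4 : 0 ≤ w ⬝ᵥ (fun i => M - l₀ i) := dotProduct_nonneg_of_nonneg hw hM'
  ext i
  have h5 := mul_eq_zero_of_dotProduct_eq_zero hw hM' (by linarith) i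
  exact (mul_eq_zero.1 h5).resolve_right (sub_pos.2 (hM i)).ne'

/-- With zero slack, the multiplier `l` is an optimality certificate for the unpenalized program. -/
theorem dotProduct_le_of_mem_penaltyKKT {F : Matrix m n ℝ} {b : m → ℝ} {v : n → ℝ} {M : ℝ}
    {u : n → ℝ} {l : m → ℝ} (h : (u, 0, l) ∈ penaltyKKT F b v M) {u' : n → ℝ} (hu' : 0 ≤ u')
    (hFu' : F *ᵥ u' ≤ b) : v ⬝ᵥ u' ≤ v ⬝ᵥ u := by
  have hobj := penaltyKKT_objective h
  have := weak_duality hu' hFu' h.2.2.2.2.2.2.2.2 h.2.1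
  simp at hobj
  linarith

/-- `M` is an exact penalty coefficient for the objectives in `V`, whatever the right-hand side. -/
def ExactPenalty (F : Matrix m n ℝ) (V : Set (n → ℝ)) (M : ℝ) : Prop :=
  ∀ v ∈ V, ∀ b, (penaltyKKT F b v M).Nonempty ∧
    ((∃ u, 0 ≤ u ∧ F *ᵥ u ≤ b) → ∀ z ∈ penaltyKKT F b v M, z.2.1 = 0)

theorem exists_exactPenalty (F : Matrix m n ℝ) (hF : ∀ u, 0 ≤ u → F *ᵥ u ≤ 0 → u = 0)
    {V : Set (n → ℝ)} (hV : V.Finite) : ∃ K : ℝ, ∀ M, K ≤ M → ExactPenalty F V M := by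
  choose K hK using exists_dual_bound F hF
  obtain ⟨C, hC⟩ := (hV.image K).bddAbove
  refine ⟨C, fun M hM v hv b => ?_⟩
  have hKM : K v ≤ M := (hC (Set.mem_image_of_mem K hv)).trans hM
  refine ⟨?_, fun hb z hz => ?_⟩
  · obtain ⟨_, l, _, _, hl, hvl, _, hlt⟩ := hK v 0 ⟨0, le_rfl, by simp⟩
    exact penaltyKKT_nonempty hl hvl (fun i => ((hlt i).trans_le hKM).le) b
  · obtain ⟨u, l, hu, hFu, hl, hvl, heq, hlt⟩ := hK v b hb
    exact eq_zero_of_mem_penaltyKKT hu hFu hl hvl heq (fun i => (hlt i).trans_le hKM) hz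

end Penalty

variable {nx mx nu mu ny kx ku ky : ℕ}

namespace Data

variable {P : Data nx mx nu mu ny kx ku ky}

/-! ### Extreme points and extreme rays of the dual feasible set -/

theorem finite_dualPoints : P.dualPoints.Finite := finite_extremePoints_nonneg_mulVec_le _ _

/-- The cone lies in the nonnegative orthant, so every nonzero element can be scaled into the slice
of coordinate sum one. This lets the results on extreme points be applied to rays. -/
theorem dualRays_eq : P.dualRays = Set.extremePoints ℝ {γ | γ ∈ P.dualCone ∧ ∑ i, γ i = 1} := by
  ext γ
  constructor
  · rintro ⟨hγ, h1, h⟩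
    refine ⟨⟨hγ, h1⟩, ?_⟩
    rintro a ⟨ha, ha1⟩ b ⟨hb, hb1⟩ ⟨s, t, hs, ht, hst, hab⟩
    have hcone : ∀ r : ℝ, 0 < r → ∀ a ∈ P.dualCone, r • a ∈ P.dualCone := fun r hr a ha =>
      ⟨smul_nonneg hr.le ha.1, by
        rw [Matrix.mulVec_smul]
        exact smul_nonpos_of_nonneg_of_nonpos hr.le ha.2⟩
    obtain ⟨r, hr⟩ := h (s • a) (hcone s hs a ha) (t • b) (hcone t ht b hb) hab
    have hsum := congrArg (fun v : Fin ky → ℝ => ∑ i, v i) hr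
    simp only [Pi.smul_apply, smul_eq_mul, ← Finset.mul_sum, ha1, h1, mul_one] at hsum
    subst hsum
    exact smul_right_injective _ hs.ne' hr
  · rintro ⟨⟨hγ, h1⟩, h⟩
    refine ⟨hγ, h1, fun a ha b hb hab => ?_⟩
    have hs : 0 ≤ ∑ i, a i := Finset.sum_nonneg fun i _ => ha.1 i
    have ht : 0 ≤ ∑ i, b i := Finset.sum_nonneg fun i _ => hb.1 i
    have hst : ∑ i, a i + ∑ i, b i = 1 := by
      rw [← Finset.sum_add_distrib, ← h1, ← hab]
      rfl
    have hzero : ∀ c ∈ P.dualCone, 0 = ∑ i, c i → c = 0 := by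
      intro c hc h0
      ext i
      exact (Finset.sum_eq_zero_iff_of_nonneg fun i _ => hc.1 i).1 h0.symm i (Finset.mem_univ i)
    rcases hs.eq_or_lt with h0 | hs
    · exact ⟨0, by rw [hzero a ha h0, zero_smul]⟩
    rcases ht.eq_or_lt with h0 | ht
    · exact ⟨1, by rw [← hab, hzero b hb h0, add_zero, one_smul]⟩
    have hmem : ∀ c ∈ P.dualCone, 0 < ∑ i, c i →
        (∑ i, c i)⁻¹ • c ∈ {γ | γ ∈ P.dualCone ∧ ∑ i, γ i = 1} := by
      intro c hc hpos
      refine ⟨⟨smul_nonneg (inv_pos.2 hpos).le hc.1, ?_⟩, ?_⟩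
      · rw [Matrix.mulVec_smul]
        exact smul_nonpos_of_nonneg_of_nonpos (inv_pos.2 hpos).le hc.2
      · simp only [Pi.smul_apply, smul_eq_mul, ← Finset.mul_sum]
        exact inv_mul_cancel₀ hpos.ne'
    have := h (hmem a ha hs) (hmem b hb ht) ⟨_, _, hs, ht, hst, by
      rw [smul_inv_smul₀ hs.ne', smul_inv_smul₀ ht.ne', hab]⟩
    exact ⟨∑ i, a i, by rw [← this, smul_inv_smul₀ hs.ne']⟩

theorem finite_dualRays : P.dualRays.Finite := by
  have h : {γ | γ ∈ P.dualCone ∧ ∑ i, γ i = 1} = {γ | 0 ≤ γ ∧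
      Matrix.fromRows P.B₂ᵀ (Matrix.fromRows (Matrix.replicateRow Unit 1)
        (-Matrix.replicateRow Unit 1)) *ᵥ γ ≤
        Sum.elim (0 : Fin ny → ℝ) (Sum.elim (1 : Unit → ℝ) (-1 : Unit → ℝ))} := by
    ext γ
    have h1 : (Matrix.replicateRow Unit (1 : Fin ky → ℝ) *ᵥ γ) () = ∑ i, γ i := by
      simp [Matrix.mulVec, dotProduct]
    constructor
    · rintro ⟨⟨h0, hB⟩, hs⟩
      refine ⟨h0, ?_⟩
      rw [Matrix.fromRows_mulVec, Matrix.fromRows_mulVec, Matrix.neg_mulVec]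
      rintro (i | i | i)
      · exact hB i
      · exact (h1.trans hs).le
      · exact neg_le_neg (h1.trans hs).ge
    · rintro ⟨h0, hB⟩
      rw [Matrix.fromRows_mulVec, Matrix.fromRows_mulVec, Matrix.neg_mulVec] at hB
      refine ⟨⟨h0, fun i => hB (Sum.inl i)⟩, le_antisymm ?_ ?_⟩
      · exact h1.ge.trans (hB (Sum.inr (Sum.inl ())))
      · exact (neg_le_neg_iff.1 (hB (Sum.inr (Sum.inr ())))).trans h1.le
  rw [dualRays_eq, h]
  exact finite_extremePoints_nonneg_mulVec_le _ _

theorem isClosed_dualCone : IsClosed P.dualCone := isClosed_nonneg_mulVec_le _ _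

/-- After scaling `γ₀` into the compact slice, the maximum of `r` there is positive and is attained
at an extreme point. -/
theorem exists_dualRay_of_pos {r γ₀ : Fin ky → ℝ} (hγ₀ : γ₀ ∈ P.dualCone) (h : 0 < r ⬝ᵥ γ₀) :
    ∃ γ ∈ P.dualRays, 0 < r ⬝ᵥ γ := by
  have hpos : 0 < ∑ i, γ₀ i := by
    refine (Finset.sum_nonneg fun i _ => hγ₀.1 i).lt_of_ne fun h0 => h.ne' ?_
    have : γ₀ = 0 := by
      ext i
      exact (Finset.sum_eq_zero_iff_of_nonneg fun i _ => hγ₀.1 i).1 h0.symm i (Finset.mem_univ i)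
    rw [this, dotProduct_zero]
  have hsum : Continuous fun x : Fin ky → ℝ => ∑ i, x i := by fun_prop
  have hcl : IsClosed {γ | γ ∈ P.dualCone ∧ ∑ i, γ i = 1} :=
    isClosed_dualCone.inter (isClosed_eq hsum continuous_const)
  have hc : IsCompact {γ | γ ∈ P.dualCone ∧ ∑ i, γ i = 1} :=
    isCompact_of_nonneg_of_sum_le hcl (fun x hx => hx.1.1) (fun x hx => hx.2.le)
  have hmem : (∑ i, γ₀ i)⁻¹ • γ₀ ∈ {γ | γ ∈ P.dualCone ∧ ∑ i, γ i = 1} := by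
    refine ⟨⟨smul_nonneg (inv_pos.2 hpos).le hγ₀.1, ?_⟩, ?_⟩
    · rw [Matrix.mulVec_smul]
      exact smul_nonpos_of_nonneg_of_nonpos (inv_pos.2 hpos).le hγ₀.2
    · simp only [Pi.smul_apply, smul_eq_mul, ← Finset.mul_sum]
      exact inv_mul_cancel₀ hpos.ne'
  have hr : Continuous fun x : Fin ky → ℝ => r ⬝ᵥ x := by
    unfold dotProduct
    fun_prop
  obtain ⟨γ₁, hγ₁, hmax⟩ := hc.exists_isMaxOn ⟨_, hmem⟩ hr.continuousOn
  obtain ⟨γ, hγ, he⟩ := exists_extremePoint_isMax hcl (fun x hx => hx.1.1) r hγ₁ hmax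
  refine ⟨γ, dualRays_eq ▸ hγ, ?_⟩
  rw [he]
  refine lt_of_lt_of_le (b := r ⬝ᵥ ((∑ i, γ₀ i)⁻¹ • γ₀)) ?_ (hmax hmem)
  rw [dotProduct_smul, smul_eq_mul]
  exact mul_pos (inv_pos.2 hpos) h

/-! ### The recourse problem -/

theorem yRhs_dotProduct_nonpos {x : Fin nx ⊕ Fin mx → ℝ} {u : (Fin nu → ℝ) × (Fin mu → ℕ)}
    {γ : Fin ky → ℝ} {y : Fin ny → ℝ} (hγ : γ ∈ P.dualCone) (hy : y ∈ P.Y x u) :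
    P.yRhs x u ⬝ᵥ γ ≤ 0 := by
  have := weak_duality (A := P.B₂ᵀ) hγ.1 hγ.2 hy.1 (c := P.yRhs x u)
    (by simpa only [Matrix.transpose_transpose] using hy.2)
  simpa using this

theorem yRhs_dotProduct_le {x : Fin nx ⊕ Fin mx → ℝ} {u : (Fin nu → ℝ) × (Fin mu → ℕ)}
    {π : Fin ky → ℝ} {y : Fin ny → ℝ} (hπ : π ∈ P.dualSet) (hy : y ∈ P.Y x u) :
    P.yRhs x u ⬝ᵥ π ≤ P.c₂ ⬝ᵥ y :=
  weak_duality (A := P.B₂ᵀ) hπ.1 hπ.2 hy.1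
    (by simpa only [Matrix.transpose_transpose] using hy.2)

theorem exists_dualCone_of_not_nonempty {x : Fin nx ⊕ Fin mx → ℝ}
    {u : (Fin nu → ℝ) × (Fin mu → ℕ)} (h : ¬ (P.Y x u).Nonempty) :
    ∃ γ ∈ P.dualCone, 0 < P.yRhs x u ⬝ᵥ γ := by
  rcases farkas (-P.B₂) (-P.yRhs x u) with ⟨y, hy, hle⟩ | ⟨γ, hγ, hB, hlt⟩
  · rw [Matrix.neg_mulVec, neg_le_neg_iff] at hle
    exact absurd ⟨y, hy, hle⟩ h
  · refine ⟨γ, ⟨hγ, ?_⟩, by simpa using hlt⟩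
    rwa [Matrix.transpose_neg, Matrix.neg_mulVec, Left.nonneg_neg_iff] at hB

/-- An empty dual set would give a recession direction of the recourse problem with negative cost,
and moving along it contradicts the lower bound in `A3`. -/
theorem dualSet_nonempty (hA3 : P.A3) {x : Fin nx ⊕ Fin mx → ℝ} (hx : x ∈ P.X)
    {u : (Fin nu → ℝ) × (Fin mu → ℕ)} (hu : u ∈ P.U x) (hY : (P.Y x u).Nonempty) :
    P.dualSet.Nonempty := by
  rcases farkas P.B₂ᵀ P.c₂ with ⟨π, hπ⟩ | ⟨w, hw, hBw, hlt⟩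
  · exact ⟨π, hπ⟩
  exfalso
  obtain ⟨y, hy⟩ := hY
  obtain ⟨C, hC⟩ := hA3
  rw [Matrix.transpose_transpose] at hBw
  have key : ∀ t : ℝ, 0 ≤ t → C ≤ P.c₁ ⬝ᵥ x + P.c₂ ⬝ᵥ y + t * (P.c₂ ⬝ᵥ w) := by
    intro t ht
    have := hC ⟨x, hx, u, hu, y + t • w, ⟨add_nonneg hy.1 (smul_nonneg ht hw), ?_⟩, rfl⟩
    · rw [dotProduct_add, dotProduct_smul, smul_eq_mul] at this
      linarith
    · rw [Matrix.mulVec_add, Matrix.mulVec_smul]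
      exact le_add_of_le_of_nonneg hy.2 (smul_nonneg ht hBw)
  have h0 := key 0 le_rfl
  -- This step length brings the total cost down to `C - 1`.
  have h1 := key ((P.c₁ ⬝ᵥ x + P.c₂ ⬝ᵥ y - C + 1) / (-(P.c₂ ⬝ᵥ w)))
    (div_nonneg (by linarith) (by linarith))
  have h2 : (P.c₁ ⬝ᵥ x + P.c₂ ⬝ᵥ y - C + 1) / (-(P.c₂ ⬝ᵥ w)) * (P.c₂ ⬝ᵥ w) =
      -(P.c₁ ⬝ᵥ x + P.c₂ ⬝ᵥ y - C + 1) := by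
    have := hlt.ne
    field_simp
  linarith

/-- Where it is feasible, the recourse problem has an optimal solution, and its dual an optimal
extreme point. -/
theorem recourse_duality (hA3 : P.A3) {x : Fin nx ⊕ Fin mx → ℝ} (hx : x ∈ P.X)
    {u : (Fin nu → ℝ) × (Fin mu → ℕ)} (hu : u ∈ P.U x) (hY : (P.Y x u).Nonempty) :
    ∃ y ∈ P.Y x u, ∃ π ∈ P.dualPoints, (∀ π' ∈ P.dualSet, P.yRhs x u ⬝ᵥ π' ≤ P.yRhs x u ⬝ᵥ π) ∧
      P.c₂ ⬝ᵥ y = P.yRhs x u ⬝ᵥ π ∧ P.recourseValue x u = ((P.yRhs x u ⬝ᵥ π : ℝ) : EReal) := by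
  obtain ⟨y₀, hy₀⟩ := hY
  obtain ⟨π₀, y, hπ₀, hB, hy, hBy, heq⟩ := strong_duality P.B₂ᵀ P.c₂ (P.yRhs x u)
    (dualSet_nonempty hA3 hx hu ⟨y₀, hy₀⟩)
    ⟨y₀, hy₀.1, by simpa only [Matrix.transpose_transpose] using hy₀.2⟩
  rw [Matrix.transpose_transpose] at hBy
  have hyY : y ∈ P.Y x u := ⟨hy, hBy⟩
  have hmax : ∀ π' ∈ P.dualSet, P.yRhs x u ⬝ᵥ π' ≤ P.yRhs x u ⬝ᵥ π₀ := fun π' hπ' =>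
    (yRhs_dotProduct_le hπ' hyY).trans heq.ge
  obtain ⟨π, hπ, he⟩ := exists_extremePoint_isMax (isClosed_nonneg_mulVec_le P.B₂ᵀ P.c₂)
    (fun _ h => h.1) (P.yRhs x u) ⟨hπ₀, hB⟩ hmax
  refine ⟨y, hyY, π, hπ, by rwa [he], by rw [he, heq], le_antisymm ?_ ?_⟩
  · rw [he, heq]
    exact iInf₂_le y hyY
  · refine le_iInf₂ fun y' hy' => ?_
    exact EReal.coe_le_coe_iff.2 (yRhs_dotProduct_le hπ.1 hy')

/-! ### The least total violation -/

/-- The dual feasible set of the problem of the least total violation. -/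
def violationDual (P : Data nx mx nu mu ny kx ku ky) : Set (Fin ky → ℝ) :=
  {γ | γ ∈ P.dualCone ∧ γ ≤ 1}

theorem isCompact_violationDual : IsCompact P.violationDual := by
  refine IsCompact.of_isClosed_subset (isCompact_Icc (a := (0 : Fin ky → ℝ)) (b := 1)) ?_
    fun γ hγ => ⟨hγ.1.1, hγ.2⟩
  exact isClosed_dualCone.inter (isClosed_le continuous_id continuous_const)

theorem zero_mem_violationDual : (0 : Fin ky → ℝ) ∈ P.violationDual :=
  ⟨⟨le_rfl, by rw [Matrix.mulVec_zero]⟩, zero_le_one⟩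

/-- No assumption is needed: `0` is dual feasible, and `y = 0` with the positive part of the
right-hand side is primal feasible. -/
theorem violation_duality (x : Fin nx ⊕ Fin mx → ℝ) (u : (Fin nu → ℝ) × (Fin mu → ℕ)) :
    ∃ γ ∈ P.violationDual, (∀ γ' ∈ P.violationDual, P.yRhs x u ⬝ᵥ γ' ≤ P.yRhs x u ⬝ᵥ γ) ∧
      P.violation x u = ((P.yRhs x u ⬝ᵥ γ : ℝ) : EReal) := by
  classical
  have hA : ∀ γ, Matrix.fromRows P.B₂ᵀ (1 : Matrix (Fin ky) (Fin ky) ℝ) *ᵥ γ =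
      Sum.elim (P.B₂ᵀ *ᵥ γ) γ := fun γ => by
    rw [Matrix.fromRows_mulVec, Matrix.one_mulVec]
  have hAT : ∀ y z, (Matrix.fromRows P.B₂ᵀ (1 : Matrix (Fin ky) (Fin ky) ℝ))ᵀ *ᵥ Sum.elim y z =
      P.B₂ *ᵥ y + z := fun y z => by
    rw [Matrix.transpose_fromRows, Matrix.fromCols_mulVec_sumElim, Matrix.transpose_transpose,
      Matrix.transpose_one, Matrix.one_mulVec]
  have hb : ∀ y z, (Sum.elim 0 1 : Fin ny ⊕ Fin ky → ℝ) ⬝ᵥ Sum.elim y z = ∑ i, z i := by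
    intro y z
    simp [dotProduct, Fintype.sum_sum_type]
  obtain ⟨γ, z, hγ, hAγ, hz, hAz, heq⟩ := strong_duality
    (Matrix.fromRows P.B₂ᵀ (1 : Matrix (Fin ky) (Fin ky) ℝ)) (Sum.elim 0 1) (P.yRhs x u)
    ⟨0, le_rfl, by
      rw [Matrix.mulVec_zero]
      rintro (i | i) <;> simp⟩
    ⟨Sum.elim 0 (P.yRhs x u)⁺, by rintro (i | i) <;> simp [posPart_nonneg], by
      rw [hAT, Matrix.mulVec_zero, zero_add]
      exact le_posPart _⟩
  obtain ⟨y, w, rfl⟩ : ∃ y w, z = Sum.elim y w := ⟨_, _, (Sum.elim_comp_inl_inr z).symm⟩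
  have hy : 0 ≤ y := fun i => hz (Sum.inl i)
  have hw : 0 ≤ w := fun i => hz (Sum.inr i)
  have hweak : ∀ γ' ∈ P.violationDual, ∀ y' w', 0 ≤ y' → 0 ≤ w' →
      P.yRhs x u ≤ P.B₂ *ᵥ y' + w' → P.yRhs x u ⬝ᵥ γ' ≤ ∑ i, w' i := by
    intro γ' hγ' y' w' hy' hw' hle
    rw [← hb y' w']
    refine weak_duality hγ'.1.1 ?_ ?_ (by rwa [hAT])
    · rw [hA]
      rintro (i | i)
      · exact hγ'.1.2 i
      · exact hγ'.2 i
    · rintro (i | i)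
      · exact hy' i
      · exact hw' i
  rw [hA] at hAγ
  rw [hAT] at hAz
  rw [hb] at heq
  have hγ' : γ ∈ P.violationDual :=
    ⟨⟨hγ, fun i => hAγ (Sum.inl i)⟩, fun i => hAγ (Sum.inr i)⟩
  refine ⟨γ, hγ', fun γ' h => heq ▸ hweak γ' h y w hy hw hAz, le_antisymm ?_ ?_⟩
  · rw [heq]
    exact iInf₂_le (y, w) ⟨hy, hw, hAz⟩
  · exact le_iInf₂ fun q hq => EReal.coe_le_coe_iff.2 (hweak γ hγ' q.1 q.2 hq.1 hq.2.1 hq.2.2)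

theorem violation_nonneg (x : Fin nx ⊕ Fin mx → ℝ) (u : (Fin nu → ℝ) × (Fin mu → ℕ)) :
    0 ≤ P.violation x u :=
  le_iInf₂ fun _ hq => EReal.coe_nonneg.2 (Finset.sum_nonneg fun i _ => hq.2.1 i)

theorem Y_nonempty_of_violation_nonpos {x : Fin nx ⊕ Fin mx → ℝ}
    {u : (Fin nu → ℝ) × (Fin mu → ℕ)} (h : P.violation x u ≤ 0) : (P.Y x u).Nonempty := by
  by_contra hY
  obtain ⟨γ₀, hγ₀, hpos₀⟩ := exists_dualCone_of_not_nonempty hY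
  obtain ⟨γ, hγ, hpos⟩ := exists_dualRay_of_pos hγ₀ hpos₀
  obtain ⟨γ', hγ', hmax, heq⟩ := violation_duality (P := P) x u
  rw [heq] at h
  -- A nonnegative ray with coordinate sum one has entries at most one, so it is a competitor in the
  -- dual of the violation problem.
  have h1 := hmax γ ⟨hγ.1, fun i => ?_⟩
  · have h2 : P.yRhs x u ⬝ᵥ γ' ≤ 0 := EReal.coe_nonpos.1 h
    linarith
  · rw [Pi.one_apply, ← hγ.2.1]
    exact Finset.single_le_sum (fun j _ => hγ.1.1 j) (Finset.mem_univ i)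

/-! ### The uncertainty set -/

theorem continuous_natCast_pi : Continuous fun v : Fin mu → ℕ => fun j => (v j : ℝ) :=
  continuous_of_discreteTopology

theorem continuous_yRhs (x : Fin nx ⊕ Fin mx → ℝ) : Continuous (P.yRhs x) := by
  unfold yRhs
  refine (continuous_const.sub ?_).sub ?_
  · exact Continuous.matrix_mulVec continuous_const continuous_fst
  · exact Continuous.matrix_mulVec continuous_const (continuous_natCast_pi.comp continuous_snd)

theorem isClosed_U (x : Fin nx ⊕ Fin mx → ℝ) : IsClosed (P.U x) := by
  have h : P.U x = {u | 0 ≤ u.1} ∩ (Prod.snd ⁻¹' (P.Ud : Set (Fin mu → ℕ)) ∩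
      {u | P.Fc x *ᵥ u.1 ≤ P.uRhs x u.2}) := rfl
  rw [h]
  refine (isClosed_le continuous_const continuous_fst).inter
    (IsClosed.inter ?_ (isClosed_le ?_ ?_))
  · exact (isClosed_discrete (P.Ud : Set (Fin mu → ℕ))).preimage continuous_snd
  · exact Continuous.matrix_mulVec continuous_const continuous_fst
  · exact (continuous_of_discreteTopology (f := P.uRhs x)).comp continuous_snd

theorem isCompact_U (hA2 : P.A2) {x : Fin nx ⊕ Fin mx → ℝ} (hx : x ∈ P.X) : IsCompact (P.U x) :=
  Metric.isCompact_of_isClosed_isBounded (isClosed_U x) (hA2 x hx)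

/-- Multiples of a nonzero `w` could be added to a point of `U x` without limit. The conclusion
concerns the matrix `Fc x` alone, which is why the penalty threshold can be a function of that
matrix. -/
theorem eq_zero_of_Fc_mulVec_nonpos (hA1 : P.A1) (hA2 : P.A2) {x : Fin nx ⊕ Fin mx → ℝ}
    (hx : x ∈ P.X) {w : Fin nu → ℝ} (hw : 0 ≤ w) (hFw : P.Fc x *ᵥ w ≤ 0) : w = 0 := by
  obtain ⟨⟨uc, ud⟩, h0, hud, hF⟩ := hA1 x hx
  obtain ⟨C, hC⟩ := (hA2 x hx).image_fst.exists_norm_le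
  ext j
  by_contra hj
  have hwj : 0 < w j := lt_of_le_of_ne (hw j) (Ne.symm hj)
  have hmem : ∀ t : ℝ, 0 ≤ t → uc + t • w ∈ Prod.fst '' P.U x := by
    intro t ht
    refine ⟨(uc + t • w, ud), ⟨add_nonneg h0 (smul_nonneg ht hw), hud, ?_⟩, rfl⟩
    show P.Fc x *ᵥ (uc + t • w) ≤ P.uRhs x ud
    rw [Matrix.mulVec_add, Matrix.mulVec_smul]
    exact (add_le_of_nonpos_right (smul_nonpos_of_nonneg_of_nonpos ht hFw)).trans hF
  have hC0 : 0 ≤ C := (norm_nonneg _).trans (hC _ (hmem 0 le_rfl))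
  have h1 := hC _ (hmem ((C + 1) / w j) (by positivity))
  have h2 := (norm_le_pi_norm (uc + ((C + 1) / w j) • w) j).trans h1
  have h3 := (le_abs_self _).trans h2
  simp only [Pi.add_apply, Pi.smul_apply, smul_eq_mul, div_mul_cancel₀ _ hwj.ne'] at h3
  have h4 := h0 j
  simp only [Pi.zero_apply] at h4
  linarith

/-! ### Solvability of the subproblems -/

/-- By duality the violation is itself a maximum over a fixed compact set, so the problem becomes
the maximization of a continuous function on a compact product. -/
theorem exists_SP1Optimal (hA1 : P.A1) (hA2 : P.A2) {x : Fin nx ⊕ Fin mx → ℝ} (hx : x ∈ P.X) :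
    ∃ u, P.SP1Optimal x u := by
  obtain ⟨u₀, hu₀⟩ := hA1 x hx
  have hcont : Continuous fun q : ((Fin nu → ℝ) × (Fin mu → ℕ)) × (Fin ky → ℝ) =>
      P.yRhs x q.1 ⬝ᵥ q.2 :=
    ((continuous_yRhs x).comp continuous_fst).dotProduct continuous_snd
  obtain ⟨⟨u, γ⟩, ⟨hu, hγ⟩, hmax⟩ := ((isCompact_U hA2 hx).prod
    isCompact_violationDual).exists_isMaxOn ⟨(u₀, 0), hu₀, zero_mem_violationDual⟩
    hcont.continuousOn
  refine ⟨u, hu, le_antisymm (le_iSup₂ (f := fun u _ => P.violation x u) u hu) ?_⟩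
  refine iSup₂_le fun u' hu' => ?_
  obtain ⟨γ₁, hγ₁, hmax₁, heq₁⟩ := violation_duality (P := P) x u
  obtain ⟨γ₂, hγ₂, hmax₂, heq₂⟩ := violation_duality (P := P) x u'
  rw [heq₁, heq₂, EReal.coe_le_coe_iff]
  have h1 : P.yRhs x u' ⬝ᵥ γ₂ ≤ P.yRhs x u ⬝ᵥ γ := hmax (a := (u', γ₂)) ⟨hu', hγ₂⟩
  exact h1.trans (hmax₁ γ hγ)

theorem exists_SP3Ray {x : Fin nx ⊕ Fin mx → ℝ} {u : (Fin nu → ℝ) × (Fin mu → ℕ)}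
    (h : 0 < P.violation x u) : ∃ γ, P.SP3Ray x u γ := by
  obtain ⟨γ₀, hγ₀, -, heq⟩ := violation_duality (P := P) x u
  rw [heq] at h
  obtain ⟨γ, hγ, hpos⟩ := exists_dualRay_of_pos hγ₀.1 (EReal.coe_pos.1 h)
  exact ⟨γ, hγ, hpos⟩

theorem etaF_nonneg (hA1 : P.A1) {x : Fin nx ⊕ Fin mx → ℝ} (hx : x ∈ P.X) : 0 ≤ P.etaF x := by
  obtain ⟨u, hu⟩ := hA1 x hx
  exact (violation_nonneg x u).trans (le_iSup₂ (f := fun u _ => P.violation x u) u hu)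

theorem firstStageFeasible_of_etaF_eq_zero {x : Fin nx ⊕ Fin mx → ℝ} (hx : x ∈ P.X)
    (h : P.etaF x = 0) : P.FirstStageFeasible x :=
  ⟨hx, fun u hu => Y_nonempty_of_violation_nonpos
    (h ▸ le_iSup₂ (f := fun u _ => P.violation x u) u hu)⟩

/-- The dual set may be unbounded, so the joint maximization runs over its finitely many extreme
points, which suffice for the recourse value. -/
theorem exists_SP2Optimal (hA1 : P.A1) (hA2 : P.A2) (hA3 : P.A3) {x : Fin nx ⊕ Fin mx → ℝ}
    (hx : P.FirstStageFeasible x) : ∃ u π, P.SP2Optimal x u π := by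
  obtain ⟨u₀, hu₀⟩ := hA1 x hx.1
  obtain ⟨_, _, π₀, hπ₀, _⟩ := recourse_duality hA3 hx.1 hu₀ (hx.2 u₀ hu₀)
  have hcont : Continuous fun q : ((Fin nu → ℝ) × (Fin mu → ℕ)) × (Fin ky → ℝ) =>
      P.yRhs x q.1 ⬝ᵥ q.2 :=
    ((continuous_yRhs x).comp continuous_fst).dotProduct continuous_snd
  obtain ⟨⟨u, π₁⟩, ⟨hu, hπ₁⟩, hmax⟩ := ((isCompact_U hA2 hx.1).prod
    finite_dualPoints.isCompact).exists_isMaxOn ⟨(u₀, π₀), hu₀, hπ₀⟩ hcont.continuousOn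
  obtain ⟨_, _, π, hπ, hπmax, _, heq⟩ := recourse_duality hA3 hx.1 hu (hx.2 u hu)
  refine ⟨u, π, hu, le_antisymm (le_iSup₂ (f := fun u _ => P.recourseValue x u) u hu) ?_,
    hπ, hπmax⟩
  refine iSup₂_le fun u' hu' => ?_
  obtain ⟨_, _, π', hπ', _, _, heq'⟩ := recourse_duality hA3 hx.1 hu' (hx.2 u' hu')
  rw [heq, heq', EReal.coe_le_coe_iff]
  have h1 : P.yRhs x u' ⬝ᵥ π' ≤ P.yRhs x u ⬝ᵥ π₁ := hmax (a := (u', π')) ⟨hu', hπ'⟩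
  exact h1.trans (hπmax π₁ hπ₁.1)

/-- The value of `SP2` is the dual value of the recourse problem at any of its solutions. -/
theorem SP2Optimal.etaO_eq (hA3 : P.A3) {x : Fin nx ⊕ Fin mx → ℝ} (hx : P.FirstStageFeasible x)
    {u : (Fin nu → ℝ) × (Fin mu → ℕ)} {π : Fin ky → ℝ} (h : P.SP2Optimal x u π) :
    P.etaO x = ((P.yRhs x u ⬝ᵥ π : ℝ) : EReal) := by
  obtain ⟨hu, heta, hπ, hmax⟩ := h
  obtain ⟨_, _, π', hπ', hmax', _, heq⟩ := recourse_duality hA3 hx.1 hu (hx.2 u hu)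
  rw [← heta, heq, le_antisymm (hmax π' hπ'.1) (hmax' π hπ.1)]

theorem exists_subproblems (hA1 : P.A1) (hA2 : P.A2) (hA3 : P.A3) {x : Fin nx ⊕ Fin mx → ℝ}
    (hx : x ∈ P.X) : ∃ g, P.Subproblems x g := by
  rcases (etaF_nonneg hA1 hx).eq_or_lt with h | h
  · obtain ⟨u, π, hu⟩ := exists_SP2Optimal hA1 hA2 hA3
      (firstStageFeasible_of_etaF_eq_zero hx h.symm)
    exact ⟨.caseA u.2 π, h.symm, u.1, hu⟩
  · obtain ⟨u, hu⟩ := exists_SP1Optimal hA1 hA2 hx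
    obtain ⟨γ, hγ⟩ := exists_SP3Ray (hu.2 ▸ h)
    exact ⟨.caseB u.2 γ, h, u.1, hu, hγ⟩

/-! ### Cutting sets -/

theorem KKT_eq (M : ℝ) (x : Fin nx ⊕ Fin mx → ℝ) (ud : Fin mu → ℕ) (β : Fin ky → ℝ) :
    P.KKT M x ud β = penaltyKKT (P.Fc x) (P.uRhs x ud) (-(P.Ecᵀ *ᵥ β)) M := by
  simp only [KKT, penaltyKKT, sub_neg_eq_add]

/-- The objective vectors `-E_cᵀ β` of the linear programs behind the cutting sets. -/
def cutObjectives (P : Data nx mx nu mu ny kx ku ky) : Set (Fin nu → ℝ) :=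
  (fun β => -(P.Ecᵀ *ᵥ β)) '' (P.dualPoints ∪ P.dualRays)

theorem finite_cutObjectives : P.cutObjectives.Finite :=
  (finite_dualPoints.union finite_dualRays).image _

theorem yRhs_dotProduct (x : Fin nx ⊕ Fin mx → ℝ) (uc : Fin nu → ℝ) (ud : Fin mu → ℕ)
    (β : Fin ky → ℝ) : P.yRhs x (uc, ud) ⬝ᵥ β =
      (P.d - P.B₁ *ᵥ x - P.Ed *ᵥ (fun j => (ud j : ℝ))) ⬝ᵥ β + -(P.Ecᵀ *ᵥ β) ⬝ᵥ uc := by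
  rw [neg_dotProduct, dotProduct_comm _ uc, dotProduct_mulVec_transpose,
    dotProduct_comm β]
  simp only [yRhs, sub_dotProduct]
  ring

/-- For fixed `x` and `ud`, the product of `yRhs` with `β` is, up to a constant, the objective of
the penalized program. Feasibility of `uc` makes the penalty exact, so `vc` maximizes this product
over all scenarios with discrete part `ud`. -/
theorem KKT_exact {M : ℝ} {x : Fin nx ⊕ Fin mx → ℝ}
    (hM : ExactPenalty (P.Fc x) P.cutObjectives M) {β : Fin ky → ℝ}
    (hβ : β ∈ P.dualPoints ∪ P.dualRays) {uc : Fin nu → ℝ} {ud : Fin mu → ℕ}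
    (hu : (uc, ud) ∈ P.U x) {vc : Fin nu → ℝ} {vt l : Fin ku → ℝ}
    (h : (vc, vt, l) ∈ P.KKT M x ud β) :
    vt = 0 ∧ P.yRhs x (uc, ud) ⬝ᵥ β ≤ P.yRhs x (vc, ud) ⬝ᵥ β := by
  rw [KKT_eq] at h
  obtain rfl : vt = 0 :=
    (hM _ (Set.mem_image_of_mem _ hβ) (P.uRhs x ud)).2 ⟨uc, hu.1, hu.2.2⟩ _ h
  refine ⟨rfl, ?_⟩
  rw [yRhs_dotProduct, yRhs_dotProduct]
  have := dotProduct_le_of_mem_penaltyKKT h hu.1 hu.2.2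
  linarith

theorem uDot_zero : uDot (0 : Fin ku → ℝ) = 0 := if_pos rfl

theorem uDot_of_ne_zero {ut : Fin ku → ℝ} (h : ut ≠ 0) : uDot ut = ⊤ := if_neg h

theorem recourseRows_zero_iff {x : Fin nx ⊕ Fin mx → ℝ} {ud : Fin mu → ℕ} {uc : Fin nu → ℝ}
    {y : Fin ny → ℝ} :
    P.RecourseRows x ud uc (0 : Fin ku → ℝ) y ↔ y ∈ P.Y x (uc, ud) := by
  refine and_congr_right fun _ => forall_congr' fun i => ?_
  rw [uDot_zero, add_zero, EReal.coe_le_coe_iff]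
  simp only [yRhs, Pi.add_apply, Pi.sub_apply]
  constructor <;> intro h <;> linarith

theorem recourseRows_of_ne_zero {x : Fin nx ⊕ Fin mx → ℝ} {ud : Fin mu → ℕ} {uc : Fin nu → ℝ}
    {ut : Fin ku → ℝ} (h : ut ≠ 0) : P.RecourseRows x ud uc ut 0 := by
  refine ⟨le_rfl, fun i => ?_⟩
  rw [uDot_of_ne_zero h, EReal.coe_add_top]
  exact le_top

theorem exists_mem_KKT {M : ℝ} {x : Fin nx ⊕ Fin mx → ℝ}
    (hM : ExactPenalty (P.Fc x) P.cutObjectives M) {β : Fin ky → ℝ}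
    (hβ : β ∈ P.dualPoints ∪ P.dualRays) (ud : Fin mu → ℕ) :
    ∃ uc ut l, (uc, ut, l) ∈ P.KKT M x ud β := by
  rw [KKT_eq]
  obtain ⟨⟨uc, ut, l⟩, h⟩ := (hM _ (Set.mem_image_of_mem _ hβ) (P.uRhs x ud)).1
  exact ⟨uc, ut, l, h⟩

theorem mem_U_of_mem_KKT_zero {M : ℝ} {x : Fin nx ⊕ Fin mx → ℝ} {β : Fin ky → ℝ}
    {uc : Fin nu → ℝ} {ud : Fin mu → ℕ} {l : Fin ku → ℝ} (hud : ud ∈ P.Ud)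
    (h : (uc, 0, l) ∈ P.KKT M x ud β) : (uc, ud) ∈ P.U x :=
  ⟨h.2.2.2.2.2.2.1, hud, by simpa using h.1⟩

/-- Cutting sets hold at every feasible first-stage decision. -/
theorem masterFeasible_of_firstStageFeasible (hA1 : P.A1) (hA2 : P.A2) (hA3 : P.A3)
    {M : (Fin nx ⊕ Fin mx → ℝ) → ℝ}
    (hM : ∀ x ∈ P.X, ExactPenalty (P.Fc x) P.cutObjectives (M x))
    {O F : Set ((Fin mu → ℕ) × (Fin ky → ℝ))} (hO : O ⊆ (P.Ud : Set _) ×ˢ P.dualPoints)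
    (hF : F ⊆ (P.Ud : Set _) ×ˢ P.dualRays) {x : Fin nx ⊕ Fin mx → ℝ}
    (hx : P.FirstStageFeasible x) : P.MasterFeasible M O F x (P.etaO x) := by
  refine ⟨hx.1, ?_, ?_, ?_⟩
  · obtain ⟨u, π, h⟩ := exists_SP2Optimal hA1 hA2 hA3 hx
    rw [h.etaO_eq hA3 hx]
    exact EReal.coe_lt_top _
  · rintro ⟨ud, π⟩ hp
    obtain ⟨uc, ut, l, h⟩ := exists_mem_KKT (hM x hx.1) (Or.inl (hO hp).2) ud
    -- If the slack is zero, the KKT point is a scenario in `U x`, and its optimal recourse costs at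
    -- most `etaO`. Otherwise `uDot` is `⊤` and every row holds with `y = 0`.
    by_cases hut : ut = 0
    · subst hut
      have hu := mem_U_of_mem_KKT_zero (hO hp).1 h
      obtain ⟨y, hy, π', _, _, heq, hval⟩ := recourse_duality hA3 hx.1 hu (hx.2 _ hu)
      refine ⟨uc, 0, l, y, h, recourseRows_zero_iff.2 hy, ?_⟩
      rw [uDot_zero, sub_zero, heq, ← hval]
      exact le_iSup₂ (f := fun u _ => P.recourseValue x u) _ hu
    · refine ⟨uc, ut, l, 0, h, recourseRows_of_ne_zero hut, ?_⟩
      rw [uDot_of_ne_zero hut, EReal.sub_top]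
      exact bot_le
  · rintro ⟨ud, γ⟩ hp
    obtain ⟨uc, ut, l, h⟩ := exists_mem_KKT (hM x hx.1) (Or.inr (hF hp).2) ud
    by_cases hut : ut = 0
    · subst hut
      have hu := mem_U_of_mem_KKT_zero (hF hp).1 h
      obtain ⟨y, hy⟩ := hx.2 _ hu
      exact ⟨uc, 0, l, y, h, recourseRows_zero_iff.2 hy⟩
    · exact ⟨uc, ut, l, 0, h, recourseRows_of_ne_zero hut⟩

theorem etaO_eq_top {x : Fin nx ⊕ Fin mx → ℝ} (hx : x ∈ P.X) (h : ¬ P.FirstStageFeasible x) :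
    P.etaO x = ⊤ := by
  obtain ⟨u, hu, hY⟩ : ∃ u ∈ P.U x, ¬ (P.Y x u).Nonempty := by
    by_contra! h'
    exact h ⟨hx, h'⟩
  have hval : P.recourseValue x u = ⊤ := by
    rw [recourseValue, Set.not_nonempty_iff_eq_empty.1 hY, iInf_emptyset]
  exact top_le_iff.1 (hval ▸ le_iSup₂ (f := fun u _ => P.recourseValue x u) u hu)

theorem masterOptimal_le_optValue (hA1 : P.A1) (hA2 : P.A2) (hA3 : P.A3)
    {M : (Fin nx ⊕ Fin mx → ℝ) → ℝ}
    (hM : ∀ x ∈ P.X, ExactPenalty (P.Fc x) P.cutObjectives (M x))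
    {O F : Set ((Fin mu → ℕ) × (Fin ky → ℝ))} (hO : O ⊆ (P.Ud : Set _) ×ˢ P.dualPoints)
    (hF : F ⊆ (P.Ud : Set _) ×ˢ P.dualRays) {x : Fin nx ⊕ Fin mx → ℝ} {η : EReal}
    (h : P.MasterOptimal M O F x η) : ((P.c₁ ⬝ᵥ x : ℝ) : EReal) + η ≤ P.optValue := by
  refine le_iInf₂ fun x' hx' => ?_
  by_cases hf : P.FirstStageFeasible x'
  · exact h.2 x' _ (masterFeasible_of_firstStageFeasible hA1 hA2 hA3 hM hO hF hf)
  · rw [etaO_eq_top hx' hf, EReal.coe_add_top]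
    exact le_top

/-! ### Repeated pairs -/

/-- For the stored pair, `etaO` is the dual value of `π` at the worst scenario. This is at most its
value at the scenario of the cut, hence at most the cost of the recourse `y` there, hence at most
`η`. -/
theorem etaO_le_of_mem {M : (Fin nx ⊕ Fin mx → ℝ) → ℝ} (hA3 : P.A3)
    {O F : Set ((Fin mu → ℕ) × (Fin ky → ℝ))} {x : Fin nx ⊕ Fin mx → ℝ} {η : EReal}
    (hM : ExactPenalty (P.Fc x) P.cutObjectives (M x)) (h : P.MasterFeasible M O F x η)
    {uc : Fin nu → ℝ} {ud : Fin mu → ℕ} {π : Fin ky → ℝ} (hf : P.FirstStageFeasible x)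
    (hsub : P.SP2Optimal x (uc, ud) π) (hmem : (ud, π) ∈ O) : P.etaO x ≤ η := by
  obtain ⟨vc, vt, l, y, hK, hrows, hη⟩ := h.2.2.1 _ hmem
  obtain ⟨rfl, hle⟩ := KKT_exact hM (Or.inl hsub.2.2.1) hsub.1 hK
  rw [uDot_zero, sub_zero] at hη
  rw [hsub.etaO_eq hA3 hf]
  refine le_trans (EReal.coe_le_coe_iff.2 ?_) hη
  exact hle.trans (yRhs_dotProduct_le hsub.2.2.1.1 (recourseRows_zero_iff.1 hrows))

/-- A stored ray would be positive at the scenario of its cut as well, although the cut supplies a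
feasible recourse there. -/
theorem SP3Ray.not_mem {M : (Fin nx ⊕ Fin mx → ℝ) → ℝ}
    {O F : Set ((Fin mu → ℕ) × (Fin ky → ℝ))} {x : Fin nx ⊕ Fin mx → ℝ} {η : EReal}
    (hM : ExactPenalty (P.Fc x) P.cutObjectives (M x)) (h : P.MasterFeasible M O F x η)
    {uc : Fin nu → ℝ} {ud : Fin mu → ℕ} {γ : Fin ky → ℝ} (hu : (uc, ud) ∈ P.U x)
    (hγ : P.SP3Ray x (uc, ud) γ) : (ud, γ) ∉ F := by
  intro hmem
  obtain ⟨vc, vt, l, y, hK, hrows⟩ := h.2.2.2 _ hmem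
  obtain ⟨rfl, hle⟩ := KKT_exact hM (Or.inr hγ.1) hu hK
  have := yRhs_dotProduct_nonpos hγ.1.1 (recourseRows_zero_iff.1 hrows)
  exact absurd hγ.2 (not_lt.2 (hle.trans this))

theorem next_stops_of_knows (hA3 : P.A3) {M : (Fin nx ⊕ Fin mx → ℝ) → ℝ}
    (hM : ∀ x ∈ P.X, ExactPenalty (P.Fc x) P.cutObjectives (M x))
    {s : State nx mx mu ky} {x : Fin nx ⊕ Fin mx → ℝ} {η : EReal} {g : Generated mu ky}
    (hit : P.Iteration M s x η g) (hk : s.Knows g) : (P.next s x η g).Stops := by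
  obtain ⟨⟨hmf, -⟩, hsub⟩ := hit
  rcases g with ⟨ud, π⟩ | ⟨ud, γ⟩
  · obtain ⟨h0, uc, hsp⟩ := hsub
    have hf := firstStageFeasible_of_etaF_eq_zero hmf.1 h0
    refine EReal.sub_nonpos.2 ((min_le_right _ _).trans ?_)
    exact add_le_add_right (etaO_le_of_mem hA3 (hM x hmf.1) hmf hf hsp hk) _
  · obtain ⟨-, uc, hsp, hray⟩ := hsub
    exact absurd hk (SP3Ray.not_mem (hM x hmf.1) hmf hsp.1 hray)

/-! ### Invariants of the algorithm -/

theorem Run.subset {M : (Fin nx ⊕ Fin mx → ℝ) → ℝ} {n : ℕ} {s : State nx mx mu ky}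
    (h : P.Run M n s) :
    s.O ⊆ (P.Ud : Set _) ×ˢ P.dualPoints ∧ s.F ⊆ (P.Ud : Set _) ×ˢ P.dualRays := by
  induction h with
  | start => exact ⟨Set.empty_subset _, Set.empty_subset _⟩
  | @iterate n s x η g _ _ hit ih =>
    rcases g with ⟨ud, π⟩ | ⟨ud, γ⟩
    · obtain ⟨-, uc, hsp⟩ := hit.2
      refine ⟨Set.union_subset ih.1 (Set.singleton_subset_iff.2 ?_), ih.2⟩
      exact ⟨hsp.1.2.1, hsp.2.2.1⟩
    · obtain ⟨-, uc, hsp, hray⟩ := hit.2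
      refine ⟨ih.1, Set.union_subset ih.2 (Set.singleton_subset_iff.2 ?_)⟩
      exact ⟨hsp.1.2.1, hray.1⟩

/-- The bound `LB < ⊤` excludes stopping with `UB = ⊤`, so a stopped run has an incumbent. -/
theorem Run.LB_le (hA1 : P.A1) (hA2 : P.A2) (hA3 : P.A3) {M : (Fin nx ⊕ Fin mx → ℝ) → ℝ}
    (hM : ∀ x ∈ P.X, ExactPenalty (P.Fc x) P.cutObjectives (M x)) {n : ℕ}
    {s : State nx mx mu ky} (h : P.Run M n s) : s.LB ≤ P.optValue ∧ s.LB < ⊤ := by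
  cases h with
  | start => exact ⟨bot_le, bot_lt_top⟩
  | iterate hrun hgo hit =>
    have hs := hrun.subset
    exact ⟨masterOptimal_le_optValue hA1 hA2 hA3 hM hs.1 hs.2 hit.1,
      EReal.add_lt_top (EReal.coe_ne_top _) hit.1.1.2.1.ne⟩

theorem Run.exists_incumbent {M : (Fin nx ⊕ Fin mx → ℝ) → ℝ} {n : ℕ} {s : State nx mx mu ky}
    (h : P.Run M n s) (hUB : s.UB < ⊤) : ∃ x, s.incumbent = some x ∧ P.FirstStageFeasible x ∧
      ((P.c₁ ⬝ᵥ x : ℝ) : EReal) + P.etaO x = s.UB := by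
  induction h with
  | start => exact absurd hUB (lt_irrefl _)
  | @iterate n s x η g _ _ hit ih =>
    by_cases hle : ((P.c₁ ⬝ᵥ x : ℝ) : EReal) + P.computedEta x g ≤ s.UB
    · have hUB' : (P.next s x η g).UB = ((P.c₁ ⬝ᵥ x : ℝ) : EReal) + P.computedEta x g :=
        min_eq_right hle
      refine ⟨x, if_pos hle, ?_⟩
      rcases g with ⟨ud, π⟩ | ⟨ud, γ⟩
      · exact ⟨firstStageFeasible_of_etaF_eq_zero hit.1.1.1 hit.2.1, hUB'.symm⟩
      · rw [hUB', computedEta, EReal.coe_add_top] at hUB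
        exact absurd hUB (lt_irrefl _)
    · have hUB' : (P.next s x η g).UB = s.UB := min_eq_left (not_le.1 hle).le
      rw [hUB'] at hUB ⊢
      obtain ⟨x', hx', h⟩ := ih hUB
      exact ⟨x', (if_neg hle).trans hx', h⟩

/-- The stopping test closes the chain `optValue ≤ UB ≤ LB ≤ optValue`, whose first inequality holds
because the incumbent attains `UB`. -/
theorem Run.exact (hA1 : P.A1) (hA2 : P.A2) (hA3 : P.A3) {M : (Fin nx ⊕ Fin mx → ℝ) → ℝ}
    (hM : ∀ x ∈ P.X, ExactPenalty (P.Fc x) P.cutObjectives (M x)) {n : ℕ}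
    {s : State nx mx mu ky} (h : P.Run M n s) (hterm : s.Stops) :
    (∃ x, s.Returns x ∧ P.IsOptimalSolution x) ∧ s.LB = P.optValue ∧ s.UB = P.optValue := by
  have hle : s.UB ≤ s.LB := EReal.sub_nonpos.1 hterm
  obtain ⟨hLB, hLBtop⟩ := h.LB_le hA1 hA2 hA3 hM
  obtain ⟨x, hx, hf, heq⟩ := h.exists_incumbent (hle.trans_lt hLBtop)
  have hopt : P.optValue ≤ s.UB := by
    rw [← heq]
    exact iInf₂_le x hf.1
  have hUB : s.UB = P.optValue := le_antisymm (hle.trans hLB) hopt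
  exact ⟨⟨x, ⟨hterm, hx⟩, hf, heq.trans hUB⟩, le_antisymm hLB (hopt.trans hle), hUB⟩

theorem Run.reportsInfeasible (hA1 : P.A1) (hA2 : P.A2) (hA3 : P.A3)
    {M : (Fin nx ⊕ Fin mx → ℝ) → ℝ}
    (hM : ∀ x ∈ P.X, ExactPenalty (P.Fc x) P.cutObjectives (M x)) {n : ℕ}
    {s : State nx mx mu ky} (h : P.Run M n s) (hr : P.ReportsInfeasible M s) : P.Infeasible :=
  fun x hx => hr.2 x _
    (masterFeasible_of_firstStageFeasible hA1 hA2 hA3 hM h.subset.1 h.subset.2 hx)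

theorem finite_points : ((P.Ud : Set (Fin mu → ℕ)) ×ˢ P.dualPoints).Finite :=
  P.Ud.finite_toSet.prod finite_dualPoints

theorem finite_rays : ((P.Ud : Set (Fin mu → ℕ)) ×ˢ P.dualRays).Finite :=
  P.Ud.finite_toSet.prod finite_dualRays

/-- An iteration either stores a new pair or stops. The second alternative, with its extra 1, covers
a final iteration that repeats a pair; no run continues from it. -/
theorem Run.card (hA3 : P.A3) {M : (Fin nx ⊕ Fin mx → ℝ) → ℝ}
    (hM : ∀ x ∈ P.X, ExactPenalty (P.Fc x) P.cutObjectives (M x)) {n : ℕ}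
    {s : State nx mx mu ky} (h : P.Run M n s) :
    n ≤ s.O.ncard + s.F.ncard ∨ s.Stops ∧ n ≤ s.O.ncard + s.F.ncard + 1 := by
  induction h with
  | start => exact Or.inl (Nat.zero_le _)
  | @iterate n s x η g hrun hgo hit ih =>
    have hn : n ≤ s.O.ncard + s.F.ncard := ih.resolve_right fun h => hgo h.1
    have hO := finite_points.subset hrun.subset.1
    have hF := finite_rays.subset hrun.subset.2
    by_cases hk : s.Knows g
    · refine Or.inr ⟨next_stops_of_knows hA3 hM hit hk, ?_⟩
      have h1 : (P.next s x η g).O.ncard + (P.next s x η g).F.ncard = s.O.ncard + s.F.ncard := by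
        rcases g with ⟨ud, π⟩ | ⟨ud, γ⟩
        · have : s.O ∪ {(ud, π)} = s.O := Set.union_eq_self_of_subset_right
            (Set.singleton_subset_iff.2 hk)
          simp only [next, this]
        · have : s.F ∪ {(ud, γ)} = s.F := Set.union_eq_self_of_subset_right
            (Set.singleton_subset_iff.2 hk)
          simp only [next, this]
      omega
    · have h1 : (P.next s x η g).O.ncard + (P.next s x η g).F.ncard =
          s.O.ncard + s.F.ncard + 1 := by
        rcases g with ⟨ud, π⟩ | ⟨ud, γ⟩
        · have : (ud, π) ∉ s.O := hk
          simp only [next, Set.union_singleton, Set.ncard_insert_of_notMem this hO]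
          omega
        · have : (ud, γ) ∉ s.F := hk
          simp only [next, Set.union_singleton, Set.ncard_insert_of_notMem this hF]
          omega
      exact Or.inl (by omega)

theorem Run.le_card (hA3 : P.A3) {M : (Fin nx ⊕ Fin mx → ℝ) → ℝ}
    (hM : ∀ x ∈ P.X, ExactPenalty (P.Fc x) P.cutObjectives (M x)) {n : ℕ}
    {s : State nx mx mu ky} (h : P.Run M n s) :
    n ≤ ((P.Ud : Set (Fin mu → ℕ)) ×ˢ P.dualPoints).ncard +
      ((P.Ud : Set (Fin mu → ℕ)) ×ˢ P.dualRays).ncard + 1 := by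
  have hO := Set.ncard_le_ncard h.subset.1 finite_points
  have hF := Set.ncard_le_ncard h.subset.2 finite_rays
  rcases h.card hA3 hM with h | ⟨-, h⟩ <;> omega

end Data

end TwoStageRO

end

/-! ### Choice of the penalty threshold and assembly. -/

theorem mainTheorem1 {nx mx nu mu ny kx ku ky : ℕ}
    (P : TwoStageRO.Data nx mx nu mu ny kx ku ky) (hA1 : P.A1) (hA2 : P.A2) (hA3 : P.A3) :
    ∃ (N : ℕ) (M₀ : Matrix (Fin ku) (Fin nu) ℝ → ℝ),
      ∀ M : (Fin nx ⊕ Fin mx → ℝ) → ℝ, (∀ x ∈ P.X, M₀ (P.Fc x) ≤ M x) →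
        -- a pair is generated again only in an iteration that ends with termination
        (∀ n s x η g, P.Run M n s → ¬ s.Stops → P.Iteration M s x η g → s.Knows g →
          (P.next s x η g).Stops) ∧
        -- a report of infeasibility is correct
        (∀ n s, P.Run M n s → P.ReportsInfeasible M s → P.Infeasible) ∧
        -- termination by the stopping test returns an exact solution and the optimal value
        (∀ n s, P.Run M n s → s.Stops →
          (∃ x, s.Returns x ∧ P.IsOptimalSolution x) ∧
            s.LB = P.optValue ∧ s.UB = P.optValue) ∧
        -- the number of iterations is bounded
        (∀ n s, P.Run M n s → n ≤ N) ∧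
        -- the subproblems never block the algorithm
        (∀ n s x η, P.Run M n s → ¬ s.Stops → P.MasterOptimal M s.O s.F x η →
          ∃ g, P.Iteration M s x η g) := by
  have hpen : ∀ F : Matrix (Fin ku) (Fin nu) ℝ, ∃ K : ℝ,
      (∀ u, 0 ≤ u → F *ᵥ u ≤ 0 → u = 0) →
        ∀ M, K ≤ M → TwoStageRO.ExactPenalty F P.cutObjectives M := by
    intro F
    by_cases hF : ∀ u, 0 ≤ u → F *ᵥ u ≤ 0 → u = 0
    · obtain ⟨K, hK⟩ := TwoStageRO.exists_exactPenalty F hF TwoStageRO.Data.finite_cutObjectives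
      exact ⟨K, fun _ => hK⟩
    · exact ⟨0, fun h => absurd h hF⟩
  choose M₀ hM₀ using hpen
  refine ⟨((P.Ud : Set (Fin mu → ℕ)) ×ˢ P.dualPoints).ncard +
    ((P.Ud : Set (Fin mu → ℕ)) ×ˢ P.dualRays).ncard + 1, M₀, fun M hM => ?_⟩
  have hex : ∀ x ∈ P.X, TwoStageRO.ExactPenalty (P.Fc x) P.cutObjectives (M x) := fun x hx =>
    hM₀ _ (fun _ => TwoStageRO.Data.eq_zero_of_Fc_mulVec_nonpos hA1 hA2 hx) _ (hM x hx)
  refine ⟨fun _ _ _ _ _ _ _ hit hk => TwoStageRO.Data.next_stops_of_knows hA3 hex hit hk,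
    fun _ _ h hr => h.reportsInfeasible hA1 hA2 hA3 hex hr,
    fun _ _ h hs => h.exact hA1 hA2 hA3 hex hs,
    fun _ _ h => h.le_card hA3 hex,
    fun _ _ x η _ _ h => ?_⟩
  obtain ⟨g, hg⟩ := TwoStageRO.Data.exists_subproblems hA1 hA2 hA3 h.1.1
  exact ⟨g, h, hg⟩
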